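/- Let $(M,g)$ be an asymptotically hyperbolic manifold of dimension $m=d+1$ (with boundary $\partial M$ at infinity), let $x$ be a special boundary defining function, so that $\bar g=x^2g$ extends to a continuous Riemannian metric up to $\partial M$ and $|dx|_{\bar g}=1$ near $\partial M$. Take a coordinate chart $(y_1,\dots,y_{m-1},x)$ near the boundary in which $x$ is the $m$-th (normal) coordinate and $\bar g(\partial_x,\partial_{y_i})=0$, $\bar g(\partial_x,\partial_x)=1$ (boundary coordinates extended along the $\bar g$-geodesics normal to $\partial M$); the chart is smooth in the interior and $C^1$ up to the boundary. Let $\bar X_s$ be the coordinate vector fields and $X_s=x\bar X_s$. A function $f$ on the chart is called polyhomogeneous (with continuous extension to $x=0$) if it is smooth for $x>0$ and $f\sim\sum_{k\ge 0}\sum_{q=0}^{q_k}a_{k,q}(y)\,x^k(\log x)^q$ at $x=0$, where $k$ runs over the integers, the $a_{k,q}$ are smooth, $a_{0,q}=0$ for $q\ge1$, and the asymptotics hold locally uniformly together with all derivatives along $x\partial_x$ and $\partial_{y_i}$. Such an $f$ is even (odd) below $x^n$ if its expansion has no logarithmic terms and no odd (even) exponents $k$ with $k<n$. Let $n\ge 0$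 be an integer and suppose that all components $\bar g(\bar X_s,\bar X_t)$ of $\bar g$ in the chart are polyhomogeneous and even below $x^n$. Then: (1) For all $p\ge 0$ and all indices, the component $r_{stuv;\alpha_1\cdots\alpha_p}$ of the $p$-th covariant derivative of the Riemann curvature tensor of $g$ in the frame $X_1,\dots,X_m$ is polyhomogeneous and is even below $x^n$ if $p+q$ is even, and odd below $x^n$ if $p+q$ is odd, where $q$ is the number of indices among $s,t,u,v,\alpha_1,\dots,\alpha_p$ that equal $m$. (2) Every scalar Riemannian invariant $P$ of $g$, i.e. every linear combination with constant coefficients of full contractions of tensor products of the curvature tensor and its covariant derivatives, is polyhomogeneous and even below $x^n$. -/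

import Mathlib

open Set Filter Topology
open scoped Manifold ContDiff

noncomputable section

namespace AH

/-! Coordinates of an `(d+1)`-dimensional manifold with boundary are indexed by `Fin (d + 1)`;
the index `0` is the normal one (the coordinate `x ≥ 0`), the indices `i.succ` are tangential
(the coordinates `y`). -/

/-- The coordinate space `ℝ^(d+1)`. -/
abbrev E (d : ℕ) : Type := EuclideanSpace ℝ (Fin (d + 1))

/-- The tangential coordinates `y` of the point `z = (x, y)`. -/
def tang {d : ℕ} (z : E d) : EuclideanSpace ℝ (Fin d) :=
  WithLp.toLp 2 (fun i : Fin d => z i.succ)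

/-- The points of `U` off the boundary, where `x > 0`. -/
def interiorPart (d : ℕ) (U : Set (E d)) : Set (E d) := {z | z ∈ U ∧ 0 < z 0}

/-- The boundary part of `U`, as a set of tangential coordinates. -/
def bdry (d : ℕ) (U : Set (E d)) : Set (EuclideanSpace ℝ (Fin d)) :=
  {y | ∃ z ∈ U, z 0 = 0 ∧ tang z = y}

/-- The partial derivative `∂_s f`. -/
def pd {d : ℕ} (s : Fin (d + 1)) (f : E d → ℝ) (z : E d) : ℝ :=
  fderiv ℝ f z (EuclideanSpace.single s (1 : ℝ))

/-! ### Polyhomogeneous expansions -/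

/-- The vector fields tangent to the boundary: `x ∂_x` (for `s = 0`) and `∂_{y_i}`. -/
def bDeriv {d : ℕ} (s : Fin (d + 1)) (f : E d → ℝ) (z : E d) : ℝ :=
  if s = 0 then z 0 * pd s f z else pd s f z

/-- The partial sum `∑_{k ≤ N} ∑_{q ≤ Q k} a_{k,q}(y) x^k (log x)^q`. -/
def phgSum {d : ℕ} (a : ℕ → ℕ → EuclideanSpace ℝ (Fin d) → ℝ) (Q : ℕ → ℕ) (N : ℕ)
    (z : E d) : ℝ :=
  ∑ k ∈ Finset.range (N + 1), ∑ q ∈ Finset.range (Q k + 1),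
    a k q (tang z) * z 0 ^ k * Real.log (z 0) ^ q

/-- `f` is polyhomogeneous conormal on the relatively open subset `U` of the half-space `x ≥ 0`,
with expansion `f ∼ ∑_k ∑_{q ≤ Q k} a_{k,q}(y) x^k (log x)^q` at `x = 0`, and extends continuously
to `x = 0` (so the exponents are non-negative and there is no `log` term at `k = 0`):
`f` is smooth in the interior, the `a_{k,q}` are smooth, and every derivative along `x ∂_x` and
the `∂_{y_i}` of the `N`-th remainder is `O(x^N)`, locally uniformly up to the boundary. -/
structure HasPhgExpansion {d : ℕ} (U : Set (E d)) (f : E d → ℝ)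
    (a : ℕ → ℕ → EuclideanSpace ℝ (Fin d) → ℝ) (Q : ℕ → ℕ) : Prop where
  smooth : ContDiffOn ℝ ∞ f (interiorPart d U)
  smooth_coeff : ∀ k q, q ≤ Q k → ContDiffOn ℝ ∞ (a k q) (bdry d U)
  no_log_zero : ∀ q, q ≤ Q 0 → q ≠ 0 → ∀ y ∈ bdry d U, a 0 q y = 0
  remainder : ∀ N : ℕ, ∀ L : List (Fin (d + 1)), ∀ z₀ ∈ U, z₀ 0 = 0 →
    (L.foldr bDeriv (fun z => f z - phgSum a Q N z))
      =O[𝓝[interiorPart d U] z₀] (fun z => z 0 ^ N)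

/-- `f` is (continuous and) polyhomogeneous on `U`, and below `x^n` its expansion has no `log` terms
and only exponents `k` with `(-1)^k = ε`. For `ε = 1`: `f` is even below `x^n`; for `ε = -1`: `f` is
odd below `x^n`. -/
def ParityBelow {d : ℕ} (U : Set (E d)) (n : ℕ) (ε : ℤ) (f : E d → ℝ) : Prop :=
  ∃ (a : ℕ → ℕ → EuclideanSpace ℝ (Fin d) → ℝ) (Q : ℕ → ℕ), HasPhgExpansion U f a Q ∧
    ∀ k, k < n → ∀ q, q ≤ Q k → (q ≠ 0 ∨ (-1 : ℤ) ^ k ≠ ε) → ∀ y ∈ bdry d U, a k q y = 0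

/-! ### Curvature in coordinates -/

/-- A metric in coordinates, `G z s t = g_z(∂_s, ∂_t)`. -/
abbrev MetricField (d : ℕ) : Type := E d → Matrix (Fin (d + 1)) (Fin (d + 1)) ℝ

/-- Christoffel symbols `Γ^k_{ij}` of the Levi-Civita connection: `∇_{∂_i} ∂_j = Γ^k_{ij} ∂_k`. -/
def christoffel {d : ℕ} (G : MetricField d) (k i j : Fin (d + 1)) (z : E d) : ℝ :=
  (1 / 2 : ℝ) * ∑ l, (G z)⁻¹ k l *
    (pd i (fun w => G w l j) z + pd j (fun w => G w l i) z - pd l (fun w => G w i j) z)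

/-- `R^s_{tuv}`, where `R(∂_u, ∂_v) ∂_t = R^s_{tuv} ∂_s` and
`R(X, Y) = [∇_X, ∇_Y] - ∇_{[X, Y]}`. -/
def riemannUp {d : ℕ} (G : MetricField d) (s t u v : Fin (d + 1)) (z : E d) : ℝ :=
  pd u (christoffel G s v t) z - pd v (christoffel G s u t) z
    + ∑ w, (christoffel G s u w z * christoffel G w v t z
      - christoffel G s v w z * christoffel G w u t z)

/-- `R_{stuv} = g(R(∂_u, ∂_v) ∂_t, ∂_s)`. -/
def riemann {d : ℕ} (G : MetricField d) (s t u v : Fin (d + 1)) (z : E d) : ℝ :=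
  ∑ w, G z s w * riemannUp G w t u v z

/-- Covariant derivative of a covariant `k`-tensor, given by its coordinate components; the last
index is the direction of differentiation:
`T_{i_1…i_k; α} = ∂_α T_{i_1…i_k} - ∑_j Γ^β_{α i_j} T_{i_1…β…i_k}`. -/
def covDeriv {d k : ℕ} (G : MetricField d) (T : (Fin k → Fin (d + 1)) → E d → ℝ)
    (J : Fin (k + 1) → Fin (d + 1)) (z : E d) : ℝ :=
  pd (J (Fin.last k)) (T (Fin.init J)) z
    - ∑ j : Fin k, ∑ β, christoffel G β (J (Fin.last k)) (Fin.init J j) z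
        * T (Function.update (Fin.init J) j β) z

/-- Coordinate components `R_{stuv; α_1 … α_p}` of the `p`-th covariant derivative of the
curvature tensor. -/
def nablaRm {d : ℕ} (G : MetricField d) : (p : ℕ) → (Fin (4 + p) → Fin (d + 1)) → E d → ℝ
  | 0 => fun J => riemann G (J 0) (J 1) (J 2) (J 3)
  | p + 1 => covDeriv (k := 4 + p) G (nablaRm G p)

/-- Components `r_{stuv; α_1 … α_p}` of the `p`-th covariant derivative of the curvature tensor in
the frame `X_s = x ∂_s`: the tensor `∇^p R` evaluated at `(X_s, X_t, X_u, X_v, X_{α_1}, …)`. Each of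
the `4 + p` arguments contributes a factor `x`. -/
def frameNablaRm {d : ℕ} (G : MetricField d) (p : ℕ) (J : Fin (4 + p) → Fin (d + 1))
    (z : E d) : ℝ :=
  z 0 ^ (4 + p) * nablaRm G p J z

/-- The number of normal indices in a multi-index. -/
def numNormal {d k : ℕ} (J : Fin k → Fin (d + 1)) : ℕ :=
  (Finset.univ.filter (fun i => J i = 0)).card

/-- A full contraction of `∇^{p_1} R ⊗ ⋯ ⊗ ∇^{p_k} R`. All indices of all factors are grouped in
pairs by `e` (the `j`-th pair consists of the slots `e (j, false)` and `e (j, true)`), and each pair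
is contracted with the inverse metric. -/
def fullContraction {d : ℕ} (G : MetricField d) {k r : ℕ} (p : Fin k → ℕ)
    (e : Fin r × Bool ≃ (i : Fin k) × Fin (4 + p i)) (z : E d) : ℝ :=
  ∑ I : ((i : Fin k) × Fin (4 + p i)) → Fin (d + 1),
    (∏ i, nablaRm G (p i) (fun a => I ⟨i, a⟩) z)
      * ∏ j : Fin r, (G z)⁻¹ (I (e (j, false))) (I (e (j, true)))

/-- The scalar Riemannian invariants: linear combinations, with constant coefficients, of full
contractions of the curvature and its covariant derivatives. -/
def scalarInvariants {d : ℕ} (G : MetricField d) : Submodule ℝ (E d → ℝ) :=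
  Submodule.span ℝ {P | ∃ (k r : ℕ) (p : Fin k → ℕ)
    (e : Fin r × Bool ≃ (i : Fin k) × Fin (4 + p i)), P = fullContraction G p e}

/-! ### Asymptotically hyperbolic manifolds -/

section Manifold

variable {d : ℕ} {M : Type*} [TopologicalSpace M] [ChartedSpace (EuclideanHalfSpace (d + 1)) M]

/-- A field of bilinear forms on the tangent spaces. -/
abbrev BilinField (d : ℕ) (M : Type*) [TopologicalSpace M]
    [ChartedSpace (EuclideanHalfSpace (d + 1)) M] : Type _ :=
  (p : M) → TangentSpace (𝓡∂ (d + 1)) p →L[ℝ] TangentSpace (𝓡∂ (d + 1)) p →L[ℝ] ℝ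

/-- `g` is a smooth metric on the interior of `M` (its values on the boundary are irrelevant), `x` is
a special boundary defining function, and `gbar` is the continuous Riemannian metric on `M` that
extends `x² g`. In particular `g` is asymptotically hyperbolic. The function `x` is only asked to be
smooth in the interior and `C¹` up to the boundary, as `gbar` need not be smooth at the boundary. -/
structure IsSpecialBdf [IsManifold (𝓡∂ (d + 1)) ∞ M] (g : BilinField d M) (x : M → ℝ)
    (gbar : Bundle.ContinuousRiemannianMetric (E d)
      (fun p : M => TangentSpace (𝓡∂ (d + 1)) p)) : Prop where
  smooth_metric : ContMDiffOn (𝓡∂ (d + 1))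
    ((𝓡∂ (d + 1)).prod 𝓘(ℝ, E d →L[ℝ] E d →L[ℝ] ℝ)) ∞
    (fun p : M => Bundle.TotalSpace.mk' (E d →L[ℝ] E d →L[ℝ] ℝ)
      (E := fun p : M => TangentSpace (𝓡∂ (d + 1)) p →L[ℝ]
        TangentSpace (𝓡∂ (d + 1)) p →L[ℝ] ℝ) p (g p))
    ((𝓡∂ (d + 1)).interior M)
  contMDiff : ContMDiff (𝓡∂ (d + 1)) 𝓘(ℝ, ℝ) 1 x
  smooth_interior : ContMDiffOn (𝓡∂ (d + 1)) 𝓘(ℝ, ℝ) ∞ x ((𝓡∂ (d + 1)).interior M)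
  eq_zero : ∀ p ∈ (𝓡∂ (d + 1)).boundary M, x p = 0
  pos : ∀ p ∈ (𝓡∂ (d + 1)).interior M, 0 < x p
  conformal : ∀ p ∈ (𝓡∂ (d + 1)).interior M, gbar.inner p = (x p) ^ 2 • g p
  /-- Near the boundary, the `gbar`-gradient of `x` has length one, i.e. `|dx| = 1`. -/
  special : ∃ W : Set M, IsOpen W ∧ (𝓡∂ (d + 1)).boundary M ⊆ W ∧ ∀ p ∈ W,
    ∃ v : TangentSpace (𝓡∂ (d + 1)) p,
      (∀ w : TangentSpace (𝓡∂ (d + 1)) p,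
        gbar.inner p v w = (mfderiv (𝓡∂ (d + 1)) 𝓘(ℝ, ℝ) x p w : ℝ)) ∧
      gbar.inner p v v = 1

/-- The coordinate vector field `∂_s` of the chart `φ`, at the point `φ⁻¹ h`. -/
def coordVec (φ : OpenPartialHomeomorph M (EuclideanHalfSpace (d + 1)))
    (h : EuclideanHalfSpace (d + 1)) (s : Fin (d + 1)) :
    TangentSpace (𝓡∂ (d + 1)) (φ.symm h) :=
  mfderiv (𝓡∂ (d + 1)) (𝓡∂ (d + 1)) φ.symm h
    (EuclideanSpace.single s (1 : ℝ) : E d)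

/-- The components of a field of bilinear forms in the chart `φ`, as functions of the
coordinates `z` of a point of the half-space. -/
def components (φ : OpenPartialHomeomorph M (EuclideanHalfSpace (d + 1)))
    (B : BilinField d M) : MetricField d :=
  fun z s t => B (φ.symm ((𝓡∂ (d + 1)).symm z))
    (coordVec φ ((𝓡∂ (d + 1)).symm z) s) (coordVec φ ((𝓡∂ (d + 1)).symm z) t)

/-- The image of a chart, as a relatively open subset of `{z ∈ ℝ^(d+1) | 0 ≤ z 0}`. -/
def chartImage (φ : OpenPartialHomeomorph M (EuclideanHalfSpace (d + 1))) : Set (E d) :=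
  (𝓡∂ (d + 1)) '' φ.target

/-- A coordinate chart `(x, y_1, …, y_d)` of `M` in which the bdf `x` is the normal coordinate and the
`y_i` are coordinates of the boundary, extended to the interior along the `gbar`-geodesics normal to
the boundary; that is, `∂_x` is the `gbar`-gradient of `x`, or `gbar(∂_x, ∂_s) = δ_{0s}` throughout
the chart. The chart is smooth in the interior and `C¹` up to the boundary. -/
structure IsAdaptedChart [IsManifold (𝓡∂ (d + 1)) ∞ M] (x : M → ℝ) (gbar : BilinField d M)
    (φ : OpenPartialHomeomorph M (EuclideanHalfSpace (d + 1))) : Prop where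
  contMDiffOn : ContMDiffOn (𝓡∂ (d + 1)) (𝓡∂ (d + 1)) 1 φ φ.source
  contMDiffOn_symm : ContMDiffOn (𝓡∂ (d + 1)) (𝓡∂ (d + 1)) 1 φ.symm φ.target
  smooth_interior : ContMDiffOn (𝓡∂ (d + 1)) (𝓡∂ (d + 1)) ∞ φ
    (φ.source ∩ (𝓡∂ (d + 1)).interior M)
  smooth_interior_symm : ContMDiffOn (𝓡∂ (d + 1)) (𝓡∂ (d + 1)) ∞ φ.symm
    (φ.target ∩ {h | 0 < h.1 0})
  normal_coord : ∀ p ∈ φ.source, (φ p).1 0 = x p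
  orthogonal : ∀ z ∈ chartImage φ, ∀ s : Fin (d + 1),
    components φ gbar z 0 s = if s = 0 then 1 else 0

end Manifold

end AH

end

/-! The heart of the matter is the reflection x ↦ -x. Even or odd below x^n means that, up to order
n, the expansion is log-free and is multiplied by 1 or -1 under the reflection. Give the normal
index the sign σ = -1 and every tangential index σ = 1. Since the components of `gbar` are even and
the mixed normal-tangential ones vanish, the component with indices s, t has sign σ_s σ_t: formally,
`gbar` is invariant under the reflection. The same holds for its inverse, and hence for g = x^{-2}
`gbar`.

The signs then pass through the coordinate formulas for the curvature. Suppose x^k f has sign ε.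
Then x^{k+1} ∂_s f has sign -ε σ_s, because x ∂_x keeps every exponent while x ∂_y raises it by one
(`ParityBelow.pow_mul_pd`). A summed index occurs twice, so its sign cancels. Thus x Γ, and then
x^{4+p} ∇^p R, have the product of the signs of their free indices, times -1 for each derivative
beyond an even number. This gives (-1)^p ∏ σ for ∇^p R (`IsConformalEven.frameNablaRm`). In a full
contraction all index signs cancel, and ∑ (4 + p_i) = 2r forces ∏ (-1)^{p_i} = 1
(`IsConformalEven.fullContraction`).

Analytically, polyhomogeneous functions with parity must be closed under sums, products, the
derivatives x ∂_x and ∂_y, and inversion of functions that do not vanish up to the boundary.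
Expansions are therefore encoded as power series in x over polynomials in log x, with conormal
remainders (`parityBelow_iff`). Products and inverses become those of power series (`HasFormal.mul`,
`HasFormal.inv_of_mul_eq_one`), and `ParityBelow.bDeriv` differentiates the coefficients directly.
The inverse metric comes from Cramer's rule, with a determinant that stays nonzero at the boundary
because `gbar` is continuous and positive definite there. -/

noncomputable section

/-! ### Conormal calculus near the boundary. -/

namespace AH

variable {d : ℕ}

/-! ### Relatively open subsets of the half-space -/

/-- `U` is a relatively open subset of the half-space `x ≥ 0`. -/
def RelOpen (U : Set (E d)) : Prop := ∃ O : Set (E d), IsOpen O ∧ U = O ∩ {z | 0 ≤ z 0}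

/-- The projection to the tangential coordinates, as a continuous linear map. -/
def tangL (d : ℕ) : E d →L[ℝ] EuclideanSpace ℝ (Fin d) :=
  LinearMap.toContinuousLinearMap
    { toFun := tang
      map_add' := fun _ _ => rfl
      map_smul' := fun _ _ => rfl }

@[simp] lemma tangL_apply (z : E d) : tangL d z = tang z := rfl

lemma continuous_tang : Continuous (tang : E d → _) := (tangL d).continuous

/-- The boundary point with given tangential coordinates. -/
def bdryPoint (y : EuclideanSpace ℝ (Fin d)) : E d :=
  WithLp.toLp 2 (Fin.cons 0 (fun i => y i))

lemma continuous_bdryPoint : Continuous (bdryPoint : _ → E d) := by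
  refine (PiLp.continuous_toLp 2 _).comp (continuous_pi fun i => ?_)
  refine Fin.cases ?_ (fun i => ?_) i
  · simpa using continuous_const
  · simp only [Fin.cons_succ]; fun_prop

@[simp] lemma bdryPoint_zero (y : EuclideanSpace ℝ (Fin d)) : bdryPoint y 0 = 0 := rfl

@[simp] lemma tang_bdryPoint (y : EuclideanSpace ℝ (Fin d)) : tang (bdryPoint y) = y := rfl

lemma bdryPoint_tang {z : E d} (hz : z 0 = 0) : bdryPoint (tang z) = z := by
  ext i
  refine Fin.cases ?_ (fun i => ?_) i
  · exact hz.symm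
  · rfl

lemma continuous_normal : Continuous (fun z : E d => z 0) := by fun_prop

variable {U : Set (E d)}

lemma RelOpen.isOpen_interiorPart (hU : RelOpen U) : IsOpen (interiorPart d U) := by
  obtain ⟨O, hO, rfl⟩ := hU
  have : interiorPart d (O ∩ {z | 0 ≤ z 0}) = O ∩ {z | 0 < z 0} := by
    ext z
    simp only [interiorPart, mem_inter_iff, mem_ofPred_eq]
    constructor
    · rintro ⟨⟨h, _⟩, h'⟩; exact ⟨h, h'⟩
    · rintro ⟨h, h'⟩; exact ⟨⟨h, h'.le⟩, h'⟩
  rw [this]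
  exact hO.inter (isOpen_lt continuous_const continuous_normal)

lemma mem_bdry_iff {y : EuclideanSpace ℝ (Fin d)} : y ∈ bdry d U ↔ bdryPoint y ∈ U := by
  constructor
  · rintro ⟨z, hz, h0, rfl⟩; rwa [bdryPoint_tang h0]
  · intro h; exact ⟨_, h, rfl, rfl⟩

lemma tang_mem_bdry {z : E d} (hz : z ∈ U) (h0 : z 0 = 0) : tang z ∈ bdry d U := ⟨z, hz, h0, rfl⟩

lemma RelOpen.isOpen_bdry (hU : RelOpen U) : IsOpen (bdry d U) := by
  obtain ⟨O, hO, rfl⟩ := hU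
  have : bdry d (O ∩ {z | 0 ≤ z 0}) = bdryPoint ⁻¹' O := by
    ext y; simp [mem_bdry_iff]
  rw [this]
  exact hO.preimage continuous_bdryPoint

/-- The interior points of `U` that lie over the boundary of `U`. -/
def collar (U : Set (E d)) : Set (E d) := interiorPart d U ∩ tang ⁻¹' bdry d U

lemma collar_subset : collar U ⊆ interiorPart d U := inter_subset_left

lemma RelOpen.isOpen_collar (hU : RelOpen U) : IsOpen (collar U) :=
  hU.isOpen_interiorPart.inter (hU.isOpen_bdry.preimage continuous_tang)

lemma pos_of_mem_collar {z : E d} (hz : z ∈ collar U) : 0 < z 0 := hz.1.2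

lemma tendsto_normal {z₀ : E d} (h0 : z₀ 0 = 0) :
    Tendsto (fun z : E d => z 0) (𝓝[collar U] z₀) (𝓝[>] 0) := by
  refine tendsto_nhdsWithin_iff.2 ⟨?_, eventually_of_mem self_mem_nhdsWithin
    fun z hz => pos_of_mem_collar hz⟩
  have := (continuous_normal (d := d)).tendsto z₀
  rw [h0] at this
  exact this.mono_left nhdsWithin_le_nhds

/-- Coefficients are controlled only over `bdry d U`, so the calculus lives on the collar. No
information at the boundary is lost: near a boundary point every tangential projection already lies
in the open set `bdry d U`. -/
lemma RelOpen.nhdsWithin_collar (hU : RelOpen U) {z₀ : E d} (hz : z₀ ∈ U) (h0 : z₀ 0 = 0) :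
    𝓝[collar U] z₀ = 𝓝[interiorPart d U] z₀ :=
  nhdsWithin_inter_of_mem' (mem_nhdsWithin_of_mem_nhds
    ((hU.isOpen_bdry.preimage continuous_tang).mem_nhds (tang_mem_bdry hz h0)))

lemma RelOpen.neBot (hU : RelOpen U) {z₀ : E d} (hz : z₀ ∈ U) (h0 : z₀ 0 = 0) :
    (𝓝[interiorPart d U] z₀).NeBot := by
  obtain ⟨O, hO, rfl⟩ := hU
  have hc : Tendsto (fun t : ℝ => z₀ + t • EuclideanSpace.single (0 : Fin (d + 1)) (1 : ℝ))
      (𝓝[>] 0) (𝓝 z₀) := by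
    have : Continuous
        (fun t : ℝ => z₀ + t • EuclideanSpace.single (0 : Fin (d + 1)) (1 : ℝ)) := by fun_prop
    simpa using (this.tendsto 0).mono_left nhdsWithin_le_nhds
  refine Tendsto.neBot (x := 𝓝[>] (0 : ℝ)) (tendsto_nhdsWithin_iff.2 ⟨hc, ?_⟩)
  filter_upwards [hc.eventually (hO.mem_nhds hz.1), self_mem_nhdsWithin] with t ht ht0
  have : 0 < (z₀ + t • EuclideanSpace.single (0 : Fin (d + 1)) (1 : ℝ)) 0 := by
    simpa [h0] using ht0
  exact ⟨⟨ht, this.le⟩, this⟩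

/-! ### Derivatives along `x ∂_x` and `∂_y` -/

/-- The coefficient of `∂_s` in the `s`-th vector field tangent to the boundary. -/
def bWeight (s : Fin (d + 1)) (z : E d) : ℝ := if s = 0 then z 0 else 1

lemma bDeriv_eq (s : Fin (d + 1)) (f : E d → ℝ) (z : E d) :
    bDeriv s f z = bWeight s z * pd s f z := by
  unfold bDeriv bWeight; split_ifs <;> simp

lemma contDiff_bWeight (s : Fin (d + 1)) : ContDiff ℝ ∞ (bWeight s : E d → ℝ) := by
  unfold bWeight
  split_ifs
  · fun_prop
  · exact contDiff_const

lemma pd_congr {V : Set (E d)} (hV : IsOpen V) {f g : E d → ℝ} (h : EqOn f g V)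
    (s : Fin (d + 1)) : EqOn (pd s f) (pd s g) V := fun z hz => by
  unfold pd
  rw [(h.eventuallyEq_of_mem (hV.mem_nhds hz)).fderiv_eq]

lemma bDeriv_congr {V : Set (E d)} (hV : IsOpen V) {f g : E d → ℝ} (h : EqOn f g V)
    (s : Fin (d + 1)) : EqOn (bDeriv s f) (bDeriv s g) V := fun z hz => by
  rw [bDeriv_eq, bDeriv_eq, pd_congr hV h s hz]

lemma ContDiffOn.pd {V : Set (E d)} (hV : IsOpen V) {f : E d → ℝ} (h : ContDiffOn ℝ ∞ f V)
    (s : Fin (d + 1)) : ContDiffOn ℝ ∞ (AH.pd s f) V :=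
  (h.fderiv_of_isOpen hV (m := ∞) (by simp)).clm_apply contDiffOn_const

lemma ContDiffOn.bDeriv {V : Set (E d)} (hV : IsOpen V) {f : E d → ℝ} (h : ContDiffOn ℝ ∞ f V)
    (s : Fin (d + 1)) : ContDiffOn ℝ ∞ (AH.bDeriv s f) V :=
  ((contDiff_bWeight s).contDiffOn.mul (ContDiffOn.pd hV h s)).congr
    fun z _ => bDeriv_eq s f z

lemma differentiableAt_of_contDiffOn {F : Type*} [NormedAddCommGroup F] [NormedSpace ℝ F]
    {V : Set F} (hV : IsOpen V) {f : F → ℝ} (h : ContDiffOn ℝ ∞ f V) {z : F}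
    (hz : z ∈ V) : DifferentiableAt ℝ f z :=
  (h.contDiffAt (hV.mem_nhds hz)).differentiableAt (by simp)

lemma pd_add {f g : E d → ℝ} {z : E d} (hf : DifferentiableAt ℝ f z)
    (hg : DifferentiableAt ℝ g z) (s : Fin (d + 1)) :
    pd s (fun z => f z + g z) z = pd s f z + pd s g z := by
  unfold pd; rw [fderiv_fun_add hf hg]; rfl

lemma pd_sub {f g : E d → ℝ} {z : E d} (hf : DifferentiableAt ℝ f z)
    (hg : DifferentiableAt ℝ g z) (s : Fin (d + 1)) :
    pd s (fun z => f z - g z) z = pd s f z - pd s g z := by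
  unfold pd; rw [fderiv_fun_sub hf hg]; rfl

lemma pd_mul {f g : E d → ℝ} {z : E d} (hf : DifferentiableAt ℝ f z)
    (hg : DifferentiableAt ℝ g z) (s : Fin (d + 1)) :
    pd s (fun z => f z * g z) z = pd s f z * g z + f z * pd s g z := by
  unfold pd; rw [fderiv_fun_mul hf hg]; simp; ring

lemma pd_sum {ι : Type*} (S : Finset ι) {f : ι → E d → ℝ} {z : E d}
    (hf : ∀ i ∈ S, DifferentiableAt ℝ (f i) z) (s : Fin (d + 1)) :
    pd s (fun z => ∑ i ∈ S, f i z) z = ∑ i ∈ S, pd s (f i) z := by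
  unfold pd; rw [fderiv_fun_sum hf]; simp

lemma pd_const (c : ℝ) (s : Fin (d + 1)) (z : E d) : pd s (fun _ => c) z = 0 := by
  unfold pd; simp

lemma pd_inv {f : E d → ℝ} {z : E d} (hf : DifferentiableAt ℝ f z) (h0 : f z ≠ 0)
    (s : Fin (d + 1)) :
    pd s (fun z => (f z)⁻¹) z = -(pd s f z * (f z)⁻¹ * (f z)⁻¹) := by
  unfold pd
  rw [show (fun z => (f z)⁻¹) = (fun t : ℝ => t⁻¹) ∘ f from rfl,
    ((hasDerivAt_inv h0).comp_hasFDerivAt z hf.hasFDerivAt).fderiv]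
  simp only [smul_apply, smul_eq_mul]
  field_simp

lemma hasFDerivAt_normal (z : E d) : HasFDerivAt (fun z : E d => z 0)
    (EuclideanSpace.proj (0 : Fin (d + 1)) : E d →L[ℝ] ℝ) z :=
  (EuclideanSpace.proj (0 : Fin (d + 1)) : E d →L[ℝ] ℝ).hasFDerivAt

/-- The derivative of a function of `x` alone. -/
lemma pd_normal {φ : ℝ → ℝ} {φ' : ℝ} {z : E d} (h : HasDerivAt φ φ' (z 0)) (s : Fin (d + 1)) :
    pd s (fun z => φ (z 0)) z = if s = 0 then φ' else 0 := by
  unfold pd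
  have := (h.comp_hasFDerivAt z (hasFDerivAt_normal z)).fderiv
  rw [show (fun z : E d => φ (z 0)) = φ ∘ fun z : E d => z 0 from rfl, this]
  simp only [smul_apply, PiLp.proj_apply, smul_eq_mul]
  by_cases hs : s = 0
  · simp [hs]
  · simp [hs, Ne.symm hs]

/-- The derivative of a function of `y` alone. -/
lemma pd_comp_tang {a : EuclideanSpace ℝ (Fin d) → ℝ} {z : E d}
    (h : DifferentiableAt ℝ a (tang z)) (s : Fin (d + 1)) :
    pd s (fun z => a (tang z)) z
      = fderiv ℝ a (tang z) (tang (EuclideanSpace.single s (1 : ℝ))) := by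
  unfold pd
  have h' : DifferentiableAt ℝ a (tangL d z) := h
  have := (h'.hasFDerivAt.comp z (tangL d).hasFDerivAt).fderiv
  rw [show (fun z : E d => a (tang z)) = a ∘ (tangL d) from rfl, this]
  rfl

lemma tang_single_zero :
    tang (EuclideanSpace.single (0 : Fin (d + 1)) (1 : ℝ)) = 0 := by
  ext i; simp [tang]

/-! ### Conormal functions -/

/-- `f` is smooth over the collar and `O(x^N)` at the boundary. -/
def ConormalBase (U : Set (E d)) (N : ℕ) (f : E d → ℝ) : Prop :=
  ContDiffOn ℝ ∞ f (collar U) ∧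
    ∀ z₀ ∈ U, z₀ 0 = 0 → f =O[𝓝[collar U] z₀] fun z => z 0 ^ N

/-- The derivatives of `f` of order at most `j` along `x ∂_x` and `∂_y` are `O(x^N)`. -/
def ConormalUpTo (U : Set (E d)) (N : ℕ) : ℕ → (E d → ℝ) → Prop
  | 0, f => ConormalBase U N f
  | j + 1, f => ConormalBase U N f ∧ ∀ s, ConormalUpTo U N j (bDeriv s f)

/-- All derivatives of `f` along `x ∂_x` and `∂_y` are `O(x^N)`. -/
def Conormal (U : Set (E d)) (N : ℕ) (f : E d → ℝ) : Prop := ∀ j, ConormalUpTo U N j f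

variable {N M : ℕ} {f g : E d → ℝ}

lemma ConormalUpTo.base {j : ℕ} (h : ConormalUpTo U N j f) : ConormalBase U N f := by
  cases j with
  | zero => exact h
  | succ j => exact h.1

lemma ConormalUpTo.pred {j : ℕ} (h : ConormalUpTo U N (j + 1) f) : ConormalUpTo U N j f := by
  induction j generalizing f with
  | zero => exact h.1
  | succ j ih => exact ⟨h.1, fun s => ih (h.2 s)⟩

lemma Conormal.base (h : Conormal U N f) : ConormalBase U N f := h 0

lemma ConormalBase.congr (h : ConormalBase U N f) (hfg : EqOn f g (collar U)) :
    ConormalBase U N g :=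
  ⟨h.1.congr fun _ hz => (hfg hz).symm, fun z₀ hz h0 => (h.2 z₀ hz h0).congr'
    (eventually_of_mem self_mem_nhdsWithin hfg) EventuallyEq.rfl⟩

lemma ConormalUpTo.congr (hU : RelOpen U) {j : ℕ} (h : ConormalUpTo U N j f)
    (hfg : EqOn f g (collar U)) : ConormalUpTo U N j g := by
  induction j generalizing f g with
  | zero => exact ConormalBase.congr h hfg
  | succ j ih =>
    exact ⟨h.1.congr hfg, fun s => ih (h.2 s) (bDeriv_congr hU.isOpen_collar hfg s)⟩

lemma Conormal.congr (hU : RelOpen U) (h : Conormal U N f) (hfg : EqOn f g (collar U)) :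
    Conormal U N g := fun j => (h j).congr hU hfg

/-- Links the inductive form of conormality to the lists of derivatives in `HasPhgExpansion`. A
right fold applies the last entry first, hence the induction from the end of the list. -/
lemma conormal_iff_foldr (hU : RelOpen U) : Conormal U N f ↔ ContDiffOn ℝ ∞ f (collar U) ∧
    ∀ L : List (Fin (d + 1)), ∀ z₀ ∈ U, z₀ 0 = 0 →
      L.foldr bDeriv f =O[𝓝[collar U] z₀] fun z => z 0 ^ N := by
  constructor
  · refine fun h => ⟨h.base.1, fun L => ?_⟩
    induction L using List.reverseRecOn generalizing f with
    | nil => exact h.base.2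
    | append_singleton L s ih =>
      simpa only [List.foldr_append, List.foldr_cons, List.foldr_nil] using ih (f := bDeriv s f) fun j => (h (j + 1)).2 s
  · intro h j
    induction j generalizing f with
    | zero => exact ⟨h.1, fun z₀ => h.2 [] z₀⟩
    | succ j ih =>
      refine ⟨⟨h.1, fun z₀ => h.2 [] z₀⟩, fun s => ih ⟨ContDiffOn.bDeriv hU.isOpen_collar h.1 s,
        fun L => ?_⟩⟩
      simpa only [List.foldr_append, List.foldr_cons, List.foldr_nil] using h.2 (L ++ [s])

lemma ConormalBase.mono (h : ConormalBase U N f) (hMN : M ≤ N) : ConormalBase U M f := by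
  refine ⟨h.1, fun z₀ hz h0 => (h.2 z₀ hz h0).trans ?_⟩
  obtain ⟨k, rfl⟩ := Nat.exists_eq_add_of_le hMN
  have : (fun z : E d => z 0 ^ k) =O[𝓝[collar U] z₀] fun _ => (1 : ℝ) :=
    (Continuous.tendsto (by fun_prop) z₀).isBigO_one ℝ |>.mono nhdsWithin_le_nhds
  simpa [pow_add] using (Asymptotics.isBigO_refl (fun z : E d => z 0 ^ M) _).mul this

lemma Conormal.mono (h : Conormal U N f) (hMN : M ≤ N) : Conormal U M f := by
  intro j
  have := h j
  clear h
  induction j generalizing f with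
  | zero => exact ConormalBase.mono this hMN
  | succ j ih => exact ⟨this.1.mono hMN, fun s => ih (this.2 s)⟩

lemma ConormalUpTo.add (hU : RelOpen U) {j : ℕ} (hf : ConormalUpTo U N j f)
    (hg : ConormalUpTo U N j g) : ConormalUpTo U N j (fun z => f z + g z) := by
  have key : ∀ {f g : E d → ℝ}, ConormalBase U N f → ConormalBase U N g →
      ConormalBase U N (fun z => f z + g z) := fun hf hg =>
    ⟨hf.1.add hg.1, fun z₀ hz h0 => (hf.2 z₀ hz h0).add (hg.2 z₀ hz h0)⟩
  induction j generalizing f g with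
  | zero => exact key hf hg
  | succ j ih =>
    refine ⟨key hf.1 hg.1, fun s => (ih (hf.2 s) (hg.2 s)).congr hU fun z hz => ?_⟩
    simp only [bDeriv_eq]
    rw [pd_add (differentiableAt_of_contDiffOn hU.isOpen_collar hf.1.1 hz)
        (differentiableAt_of_contDiffOn hU.isOpen_collar hg.1.1 hz), mul_add]

/-- Leibniz rule, by induction on the order: one factor loses a derivative, the other is merely
weakened to the lower order. -/
lemma ConormalUpTo.mul (hU : RelOpen U) {j : ℕ} (hf : ConormalUpTo U N j f)
    (hg : ConormalUpTo U M j g) : ConormalUpTo U (N + M) j (fun z => f z * g z) := by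
  have key : ∀ {f g : E d → ℝ}, ConormalBase U N f → ConormalBase U M g →
      ConormalBase U (N + M) (fun z => f z * g z) := fun hf hg =>
    ⟨hf.1.mul hg.1, fun z₀ hz h0 => by
      simpa only [pow_add] using (hf.2 z₀ hz h0).mul (hg.2 z₀ hz h0)⟩
  induction j generalizing f g with
  | zero => exact key hf hg
  | succ j ih =>
    refine ⟨key hf.1 hg.1, fun s => ((ih (hf.2 s) hg.pred).add hU
      (ih hf.pred (hg.2 s))).congr hU fun z hz => ?_⟩
    simp only [bDeriv_eq]
    rw [pd_mul (differentiableAt_of_contDiffOn hU.isOpen_collar hf.1.1 hz)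
        (differentiableAt_of_contDiffOn hU.isOpen_collar hg.1.1 hz)]
    ring

lemma ConormalUpTo.zero (hU : RelOpen U) (j : ℕ) : ConormalUpTo U N j (fun _ => 0) := by
  have key : ConormalBase U N (fun _ => 0) :=
    ⟨contDiffOn_const, fun _ _ _ => Asymptotics.isBigO_zero _ _⟩
  induction j with
  | zero => exact key
  | succ j ih => exact ⟨key, fun s => ih.congr hU fun z _ => by simp [bDeriv_eq, pd_const]⟩

lemma conormal_const (hU : RelOpen U) (c : ℝ) : Conormal U 0 (fun _ => c) := by
  have key : ConormalBase U 0 (fun _ => c) :=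
    ⟨contDiffOn_const, fun z₀ _ _ => by simpa using Asymptotics.isBigO_const_const c (one_ne_zero (α := ℝ)) _⟩
  intro j
  cases j with
  | zero => exact key
  | succ j =>
    exact ⟨key, fun s => (ConormalUpTo.zero hU j).congr hU fun z _ => by
      simp [bDeriv_eq, pd_const]⟩

lemma Conormal.add (hU : RelOpen U) (hf : Conormal U N f) (hg : Conormal U N g) :
    Conormal U N (fun z => f z + g z) := fun j => (hf j).add hU (hg j)

lemma Conormal.mul (hU : RelOpen U) (hf : Conormal U N f) (hg : Conormal U M g) :
    Conormal U (N + M) (fun z => f z * g z) := fun j => (hf j).mul hU (hg j)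

lemma Conormal.const_mul (hU : RelOpen U) (c : ℝ) (hf : Conormal U N f) :
    Conormal U N (fun z => c * f z) := by
  simpa using (conormal_const hU c).mul hU hf

lemma Conormal.sub (hU : RelOpen U) (hf : Conormal U N f) (hg : Conormal U N g) :
    Conormal U N (fun z => f z - g z) :=
  (hf.add hU (hg.const_mul hU (-1))).congr hU fun z _ => by ring

lemma Conormal.sum (hU : RelOpen U) {ι : Type*} (S : Finset ι) {f : ι → E d → ℝ}
    (h : ∀ i ∈ S, Conormal U N (f i)) : Conormal U N (fun z => ∑ i ∈ S, f i z) := by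
  classical
  induction S using Finset.induction_on with
  | empty => exact fun j => by simpa using ConormalUpTo.zero hU j
  | insert i S hi ih =>
    simp only [Finset.sum_insert hi]
    exact (h i (Finset.mem_insert_self _ _)).add hU
      (ih fun k hk => h k (Finset.mem_insert_of_mem hk))

/-- Only 1/f itself needs a bound. Its derivative along a tangent field V is -(Vf) f⁻¹ f⁻¹, so order
j + 1 for 1/f follows from order j. -/
lemma Conormal.inv (hU : RelOpen U) (hf : Conormal U 0 f) (h0 : ∀ z ∈ collar U, f z ≠ 0)
    (hb : ∀ z₀ ∈ U, z₀ 0 = 0 → (fun z => (f z)⁻¹) =O[𝓝[collar U] z₀] fun _ => (1 : ℝ)) :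
    Conormal U 0 (fun z => (f z)⁻¹) := by
  have key : ConormalBase U 0 (fun z => (f z)⁻¹) :=
    ⟨hf.base.1.inv h0, by simpa using hb⟩
  intro j
  induction j with
  | zero => exact key
  | succ j ih =>
    refine ⟨key, fun s => ((conormal_const hU (-1) j).mul hU
      (((hf (j + 1)).2 s).mul hU (ih.mul hU ih))).congr hU fun z hz => ?_⟩
    simp only [bDeriv_eq]
    rw [pd_inv (differentiableAt_of_contDiffOn hU.isOpen_collar hf.base.1 hz) (h0 z hz)]
    ring

lemma conormal_comp_tang (hU : RelOpen U) {a : EuclideanSpace ℝ (Fin d) → ℝ}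
    (ha : ContDiffOn ℝ ∞ a (bdry d U)) : Conormal U 0 (fun z => a (tang z)) := by
  have key : ∀ {a : EuclideanSpace ℝ (Fin d) → ℝ}, ContDiffOn ℝ ∞ a (bdry d U) →
      ConormalBase U 0 (fun z => a (tang z)) := fun {a} ha => by
    refine ⟨ha.comp (tangL d).contDiff.contDiffOn fun z hz => hz.2, fun z₀ hz h0 => ?_⟩
    have h1 : ContinuousAt a (tang z₀) :=
      ha.continuousOn.continuousAt (hU.isOpen_bdry.mem_nhds (tang_mem_bdry hz h0))
    have h2 : Tendsto (fun z => a (tang z)) (𝓝 z₀) (𝓝 (a (tang z₀))) :=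
      h1.tendsto.comp (continuous_tang.tendsto z₀)
    simpa using (h2.isBigO_one ℝ).mono nhdsWithin_le_nhds
  intro j
  induction j generalizing a with
  | zero => exact key ha
  | succ j ih =>
    refine ⟨key ha, fun s => ?_⟩
    have h1 : EqOn (fun z => fderiv ℝ a (tang z) (tang (EuclideanSpace.single s (1 : ℝ))))
        (bDeriv s fun z => a (tang z)) (collar U) := fun z hz => by
      rw [bDeriv_eq, pd_comp_tang (differentiableAt_of_contDiffOn hU.isOpen_bdry ha hz.2)]
      -- Functions of y alone are killed by x ∂_x, and ∂_y produces another function of y alone, so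
      -- the induction closes.
      by_cases hs : s = 0
      · subst hs; simp [tang_single_zero]
      · simp [bWeight, hs]
    refine (ih (a := fun y => fderiv ℝ a y (tang (EuclideanSpace.single s (1 : ℝ)))) ?_).congr hU h1
    exact (ha.fderiv_of_isOpen hU.isOpen_bdry (m := ∞) (by simp)).clm_apply contDiffOn_const

lemma conormal_normal (hU : RelOpen U) : Conormal U 1 (fun z => z 0) := by
  have key : ConormalBase U 1 (fun z => z 0) :=
    ⟨by fun_prop, fun z₀ _ _ => by simpa using Asymptotics.isBigO_refl _ _⟩
  intro j
  induction j with
  | zero => exact key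
  | succ j ih =>
    refine ⟨key, fun s => ?_⟩
    by_cases hs : s = 0
    · refine ih.congr hU fun z _ => ?_
      rw [bDeriv_eq, pd_normal (φ := fun t => t) (hasDerivAt_id' (z 0))]
      simp [bWeight, hs]
    · refine (ConormalUpTo.zero hU j).congr hU fun z _ => ?_
      rw [bDeriv_eq, pd_normal (φ := fun t => t) (hasDerivAt_id' (z 0))]
      simp [hs]

lemma conormal_normal_pow (hU : RelOpen U) (k : ℕ) : Conormal U k (fun z => z 0 ^ k) := by
  induction k with
  | zero => simpa using conormal_const hU 1
  | succ k ih => simpa only [pow_succ] using ih.mul hU (conormal_normal hU)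

/-- Substituting t = 1/u turns this into log^q u = o(u) at infinity. -/
lemma tendsto_mul_log_pow (q : ℕ) :
    Tendsto (fun t : ℝ => t * Real.log t ^ q) (𝓝[>] 0) (𝓝 0) := by
  have h := (Real.isLittleO_pow_log_id_atTop (n := q)).tendsto_div_nhds_zero
  have h2 := h.comp tendsto_inv_nhdsGT_zero
  have h3 := (h2.const_mul ((-1 : ℝ) ^ q))
  simp only [mul_zero] at h3
  refine h3.congr fun t => ?_
  simp only [Function.comp, Real.log_inv, id, div_inv_eq_mul, neg_pow (Real.log t) q]
  have : ((-1 : ℝ) ^ q) * (-1) ^ q = 1 := by rw [← mul_pow]; simp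
  linear_combination (Real.log t ^ q * t) * this

lemma conormal_normal_mul_log_pow (hU : RelOpen U) (q : ℕ) :
    Conormal U 0 (fun z => z 0 * Real.log (z 0) ^ q) := by
  have key : ∀ q : ℕ, ConormalBase U 0 (fun z => z 0 * Real.log (z 0) ^ q) := fun q => by
    refine ⟨fun z hz => ?_, fun z₀ _ h0 => ?_⟩
    · have h := (pos_of_mem_collar hz).ne'
      have h1 : ContDiffAt ℝ ∞ (fun z : E d => z 0) z := by fun_prop
      exact (h1.mul ((h1.log h).pow q)).contDiffWithinAt
    · simpa using ((tendsto_mul_log_pow q).comp (tendsto_normal h0)).isBigO_one ℝ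
  intro j
  induction j generalizing q with
  | zero => exact key q
  | succ j ih =>
    refine ⟨key q, fun s => ?_⟩
    -- After multiplication by x this stays in the family x log^q x, which is why the induction is
    -- uniform in q. For q = 0 the truncated exponent q - 1 has coefficient 0.
    have hd : ∀ z ∈ collar U, pd s (fun z => z 0 * Real.log (z 0) ^ q) z = if s = 0 then
        Real.log (z 0) ^ q + q * Real.log (z 0) ^ (q - 1) else 0 := fun z hz => by
      have h := (pos_of_mem_collar hz).ne'
      refine pd_normal (φ := fun t => t * Real.log t ^ q) ?_ s
      refine ((hasDerivAt_id' (z 0)).mul ((Real.hasDerivAt_log h).pow q)).congr_deriv ?_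
      simp only [Pi.pow_apply]
      field_simp
    by_cases hs : s = 0
    · refine ((ih q).add hU ((conormal_const hU q j).mul hU (ih (q - 1)))).congr hU
        fun z hz => ?_
      simp only [bDeriv_eq]
      rw [hd z hz]
      simp [bWeight, hs]; ring
    · refine (ConormalUpTo.zero hU j).congr hU fun z hz => ?_
      simp only [bDeriv_eq]
      rw [hd z hz]
      simp [hs]

end AH
end

/-! ### The ring of formal expansions and its parity. -/

noncomputable section

namespace AH

variable {d : ℕ}

/-! ### Formal expansions -/

section Parity

variable {A : Type*} [CommRing A] {n : ℕ} {ε ε' : ℤ} {F G : PowerSeries (Polynomial A)}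

/-- Below `x^n`, the expansion `F` has no `log` terms and only exponents `k` with `(-1)^k = ε`. -/
def FormalParity (n : ℕ) (ε : ℤ) (F : PowerSeries (Polynomial A)) : Prop :=
  ∀ k < n, ∃ a, PowerSeries.coeff k F = Polynomial.C a ∧ ((-1 : ℤ) ^ k ≠ ε → a = 0)

lemma FormalParity.add (hF : FormalParity n ε F) (hG : FormalParity n ε G) :
    FormalParity n ε (F + G) := fun k hk => by
  obtain ⟨a, ha, ha'⟩ := hF k hk
  obtain ⟨b, hb, hb'⟩ := hG k hk
  exact ⟨a + b, by rw [map_add, ha, hb, map_add], fun h => by rw [ha' h, hb' h, add_zero]⟩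

lemma coeff_sum_parity {ι : Type*} (S : Finset ι) {P : ι → Polynomial A} {p : Prop}
    (h : ∀ i ∈ S, ∃ a, P i = Polynomial.C a ∧ (p → a = 0)) :
    ∃ a, ∑ i ∈ S, P i = Polynomial.C a ∧ (p → a = 0) := by
  classical
  induction S using Finset.induction_on with
  | empty => exact ⟨0, by simp⟩
  | insert i S hi ih =>
    obtain ⟨a, ha, ha'⟩ := h i (Finset.mem_insert_self _ _)
    obtain ⟨b, hb, hb'⟩ := ih fun k hk => h k (Finset.mem_insert_of_mem hk)
    exact ⟨a + b, by rw [Finset.sum_insert hi, ha, hb, map_add],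
      fun h => by rw [ha' h, hb' h, add_zero]⟩

lemma FormalParity.mul (hF : FormalParity n ε F) (hG : FormalParity n ε' G) :
    FormalParity n (ε * ε') (F * G) := fun k hk => by
  rw [PowerSeries.coeff_mul]
  refine coeff_sum_parity _ fun ⟨i, j⟩ hij => ?_
  have hij : i + j = k := by simpa using hij
  obtain ⟨a, ha, ha'⟩ := hF i (by omega)
  obtain ⟨b, hb, hb'⟩ := hG j (by omega)
  refine ⟨a * b, by rw [ha, hb, map_mul], fun h => ?_⟩
  by_cases h1 : (-1 : ℤ) ^ i = ε
  · rw [hb' (fun h2 => h (by rw [← hij, pow_add, h1, h2])), mul_zero]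
  · rw [ha' h1, zero_mul]

lemma FormalParity.of_mul_eq_one (hF : FormalParity n 1 F) (hFG : F * G = 1)
    {a b : A} (ha : PowerSeries.coeff 0 F = Polynomial.C a) (hab : b * a = 1) :
    FormalParity n 1 G := fun k => by
  induction k using Nat.strong_induction_on with
  | _ k ih =>
    intro hk
    have h1 : PowerSeries.coeff k (F * G) =
        PowerSeries.coeff k (1 : PowerSeries (Polynomial A)) := by rw [hFG]
    -- Isolate the term F₀ G_k: the other terms involve only G_j with j < k, and F₀ is inverted by
    -- b.
    rw [PowerSeries.coeff_mul, Finset.Nat.sum_antidiagonal_eq_sum_range_succ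
      (fun i j => PowerSeries.coeff i F * PowerSeries.coeff j G), Finset.sum_range_succ', ha,
      PowerSeries.coeff_one] at h1
    replace h1 := eq_sub_of_add_eq' h1
    simp only [Nat.sub_zero] at h1
    obtain ⟨c, hc, hc'⟩ := coeff_sum_parity (p := (-1 : ℤ) ^ k ≠ 1) (Finset.range k)
      (P := fun i => PowerSeries.coeff (i + 1) F * PowerSeries.coeff (k - (i + 1)) G) fun i hi => by
        have hi' := Finset.mem_range.1 hi
        obtain ⟨a, ha, ha'⟩ := hF (i + 1) (by omega)
        obtain ⟨b, hb, hb'⟩ := ih (k - (i + 1)) (by omega) (by omega)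
        refine ⟨a * b, by rw [ha, hb, map_mul], fun h => ?_⟩
        by_cases h1 : (-1 : ℤ) ^ (i + 1) = 1
        · rw [hb' (fun h2 => h ?_), mul_zero]
          rw [show k = (i + 1) + (k - (i + 1)) by omega, pow_add, h1, h2, mul_one]
        · rw [ha' h1, zero_mul]
    rw [hc] at h1
    refine ⟨b * ((if k = 0 then 1 else 0) - c), ?_, fun h => ?_⟩
    · have h2 := congrArg (fun P => Polynomial.C b * P) h1
      simp only [← mul_assoc, ← map_mul, hab, map_one, one_mul] at h2
      rw [h2, map_mul, map_sub]
      split_ifs <;> simp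
    · rw [hc' h, if_neg (by rintro rfl; simp at h)]; simp

lemma exists_mul_eq_one {a b : A} (ha : PowerSeries.coeff 0 F = Polynomial.C a)
    (hab : a * b = 1) :
    ∃ G : PowerSeries (Polynomial A), F * G = 1 ∧ PowerSeries.coeff 0 G = Polynomial.C b := by
  let v : (Polynomial A)ˣ := ⟨Polynomial.C a, Polynomial.C b, by rw [← map_mul, hab, map_one],
      by rw [← map_mul, mul_comm, hab, map_one]⟩
  refine ⟨PowerSeries.invOfUnit F v, PowerSeries.mul_invOfUnit F v ?_, ?_⟩
  · rw [← PowerSeries.coeff_zero_eq_constantCoeff_apply, ha]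
  · rw [PowerSeries.coeff_zero_eq_constantCoeff_apply, PowerSeries.constantCoeff_invOfUnit]
    rfl

end Parity

/-- The functions on `ℝ^d` that are smooth on `B`. -/
def CoefRing (B : Set (EuclideanSpace ℝ (Fin d))) :
    Subalgebra ℝ (EuclideanSpace ℝ (Fin d) → ℝ) where
  carrier := {a | ContDiffOn ℝ ∞ a B}
  mul_mem' ha hb := ContDiffOn.mul ha hb
  add_mem' ha hb := ContDiffOn.add ha hb
  algebraMap_mem' _ := contDiffOn_const

/-- Formal power series in `x` whose coefficients are polynomials in `log x`. -/
abbrev Formal (B : Set (EuclideanSpace ℝ (Fin d))) : Type :=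
  PowerSeries (Polynomial (CoefRing B))

variable {B : Set (EuclideanSpace ℝ (Fin d))}

/-- The value of a coefficient at `y`. -/
def evalCoef (B : Set (EuclideanSpace ℝ (Fin d))) (y : EuclideanSpace ℝ (Fin d)) :
    CoefRing B →+* ℝ :=
  (Pi.evalRingHom (fun _ => ℝ) y).comp (CoefRing B).val.toRingHom

@[simp] lemma evalCoef_apply (y : EuclideanSpace ℝ (Fin d)) (a : CoefRing B) :
    evalCoef B y a = (a : EuclideanSpace ℝ (Fin d) → ℝ) y := rfl

/-- The value at `z` of a polynomial in `log x`. -/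
def evalLog (B : Set (EuclideanSpace ℝ (Fin d))) (z : E d) : Polynomial (CoefRing B) →+* ℝ :=
  Polynomial.eval₂RingHom (evalCoef B (tang z)) (Real.log (z 0))

@[simp] lemma evalLog_C (z : E d) (a : CoefRing B) :
    evalLog B z (Polynomial.C a) = (a : EuclideanSpace ℝ (Fin d) → ℝ) (tang z) := by
  simp [evalLog]

lemma evalLog_eq_sum (z : E d) (P : Polynomial (CoefRing B)) : evalLog B z P
    = ∑ q ∈ Finset.range (P.natDegree + 1),
      (P.coeff q : EuclideanSpace ℝ (Fin d) → ℝ) (tang z) * Real.log (z 0) ^ q := by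
  simp [evalLog, Polynomial.eval₂_eq_sum_range]

/-- The partial sum up to `x^N` of a formal expansion. -/
def partialSum (F : Formal B) (N : ℕ) (z : E d) : ℝ :=
  ∑ k ∈ Finset.range (N + 1), evalLog B z (PowerSeries.coeff k F) * z 0 ^ k

lemma partialSum_add (F G : Formal B) (N : ℕ) (z : E d) :
    partialSum (F + G) N z = partialSum F N z + partialSum G N z := by
  simp [partialSum, add_mul, Finset.sum_add_distrib]

lemma partialSum_C (P : Polynomial (CoefRing B)) (N : ℕ) (z : E d) :
    partialSum (PowerSeries.C P) N z = evalLog B z P := by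
  unfold partialSum
  rw [Finset.sum_eq_single 0]
  · simp
  · intro k _ hk; simp [PowerSeries.coeff_C, hk]
  · simp

lemma partialSum_X_succ (N : ℕ) (z : E d) :
    partialSum (PowerSeries.X : Formal B) (N + 1) z = z 0 := by
  unfold partialSum
  rw [Finset.sum_eq_single 1]
  · simp
  · intro k _ hk; simp [PowerSeries.coeff_X, hk]
  · simp

lemma partialSum_X_zero (z : E d) : partialSum (PowerSeries.X : Formal B) 0 z = 0 := by
  simp [partialSum]

variable {U : Set (E d)}

/-- One power of x is spent on absorbing the logarithms. This is why the remainder after the terms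
through x^N is measured by x^N. -/
lemma conormal_term (hU : RelOpen U) (P : Polynomial (CoefRing (bdry d U))) (k : ℕ) :
    Conormal U k (fun z => evalLog (bdry d U) z P * z 0 ^ (k + 1)) := by
  refine (Conormal.sum hU (Finset.range (P.natDegree + 1)) (f := fun q z =>
    (P.coeff q : EuclideanSpace ℝ (Fin d) → ℝ) (tang z)
      * ((z 0 * Real.log (z 0) ^ q) * z 0 ^ k)) fun q _ => ?_).congr hU fun z _ => ?_
  · have := (conormal_comp_tang hU (P.coeff q).2).mul hU
      ((conormal_normal_mul_log_pow hU q).mul hU (conormal_normal_pow hU k))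
    simpa using this
  · simp only [evalLog_eq_sum, Finset.sum_mul]
    exact Finset.sum_congr rfl fun q _ => by ring

lemma tendsto_term (hU : RelOpen U) (P : Polynomial (CoefRing (bdry d U))) {z₀ : E d}
    (hz : z₀ ∈ U) (h0 : z₀ 0 = 0) :
    Tendsto (fun z => evalLog (bdry d U) z P * z 0) (𝓝[collar U] z₀) (𝓝 0) := by
  have : Tendsto (fun z => ∑ q ∈ Finset.range (P.natDegree + 1),
      (P.coeff q : EuclideanSpace ℝ (Fin d) → ℝ) (tang z) * (z 0 * Real.log (z 0) ^ q))
      (𝓝[collar U] z₀) (𝓝 (∑ q ∈ Finset.range (P.natDegree + 1),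
      (P.coeff q : EuclideanSpace ℝ (Fin d) → ℝ) (tang z₀) * 0)) := by
    refine tendsto_finsetSum _ fun q _ => Tendsto.mul ?_ ((tendsto_mul_log_pow q).comp (tendsto_normal h0))
    have h1 : ContinuousAt (P.coeff q : EuclideanSpace ℝ (Fin d) → ℝ) (tang z₀) :=
      (P.coeff q).2.continuousOn.continuousAt
        (hU.isOpen_bdry.mem_nhds (tang_mem_bdry hz h0))
    exact (h1.tendsto.comp (continuous_tang.tendsto z₀)).mono_left nhdsWithin_le_nhds
  simp only [mul_zero, Finset.sum_const_zero] at this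
  refine this.congr fun z => ?_
  rw [evalLog_eq_sum, Finset.sum_mul]
  exact Finset.sum_congr rfl fun q _ => by ring

lemma partialSum_eq_eval₂ (F : Formal B) (N : ℕ) (z : E d) :
    partialSum F N z = (PowerSeries.trunc (N + 1) F).eval₂ (evalLog B z) (z 0) := by
  rw [PowerSeries.eval₂_trunc_eq_sum_range]; rfl

/-- The product of the truncations agrees with the product series through x^N. What is left is a
finite sum of terms x^{k+1} with k ≥ N and polynomial coefficients in log x. -/
lemma conormal_partialSum_mul (hU : RelOpen U) (F G : Formal (bdry d U)) (N : ℕ) :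
    Conormal U N (fun z => partialSum F N z * partialSum G N z - partialSum (F * G) N z) := by
  set p := PowerSeries.trunc (N + 1) F * PowerSeries.trunc (N + 1) G with hp
  have h1 : ∀ z : E d, partialSum F N z * partialSum G N z - partialSum (F * G) N z
      = ∑ k ∈ Finset.range p.natDegree,
        if N ≤ k then evalLog (bdry d U) z (p.coeff (k + 1)) * z 0 ^ (k + 1) else 0 := fun z => by
    have hK : p.natDegree < p.natDegree + N + 1 := by omega
    rw [partialSum_eq_eval₂, partialSum_eq_eval₂, ← Polynomial.eval₂_mul, ← hp,
      Polynomial.eval₂_eq_sum_range' _ hK, partialSum, sub_eq_iff_eq_add',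
      show p.natDegree + N + 1 = N + 1 + p.natDegree by ring, Finset.sum_range_add]
    congr 1
    · refine Finset.sum_congr rfl fun k hk => ?_
      rw [PowerSeries.coeff_mul_eq_coeff_trunc_mul_trunc F G (Finset.mem_range.1 hk),
        ← Polynomial.coe_mul, ← hp, Polynomial.coeff_coe]
    · have : ∀ M : ℕ, ∑ x ∈ Finset.range M, evalLog (bdry d U) z (p.coeff (N + 1 + x))
          * z 0 ^ (N + 1 + x) = ∑ k ∈ Finset.range (M + N), if N ≤ k then
            evalLog (bdry d U) z (p.coeff (k + 1)) * z 0 ^ (k + 1) else 0 := fun M => by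
        rw [add_comm M N, Finset.sum_range_add]
        refine Eq.trans ?_ (add_eq_right.2 (Finset.sum_eq_zero fun k hk => ?_)).symm
        rotate_left
        · rw [if_neg (by simpa using hk)]
        · refine Finset.sum_congr rfl fun k _ => ?_
          rw [if_pos (by omega), show N + k + 1 = N + 1 + k by ring]
      rw [this, Finset.sum_range_add, add_eq_left]
      refine Finset.sum_eq_zero fun k _ => ?_
      rw [Polynomial.coeff_eq_zero_of_natDegree_lt (by omega)]
      simp
  simp only [h1]
  refine Conormal.sum hU _ fun k _ => ?_
  split_ifs with h
  · exact (conormal_term hU _ k).mono h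
  · exact fun j => ConormalUpTo.zero hU j

/-- The smooth function `f` on the interior part of `U` has the formal expansion `F`. -/
structure HasFormal (U : Set (E d)) (f : E d → ℝ) (F : Formal (bdry d U)) : Prop where
  smooth : ContDiffOn ℝ ∞ f (interiorPart d U)
  no_log_zero : ∃ a, PowerSeries.coeff 0 F = Polynomial.C a
  remainder : ∀ N, Conormal U N (fun z => f z - partialSum F N z)

lemma partialSum_zero_eq {F : Formal B} {a : CoefRing B}
    (h : PowerSeries.coeff 0 F = Polynomial.C a) (z : E d) :
    partialSum F 0 z = (a : EuclideanSpace ℝ (Fin d) → ℝ) (tang z) := by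
  simp [partialSum, h, -PowerSeries.coeff_zero_eq_constantCoeff]

variable {f g : E d → ℝ} {F G : Formal (bdry d U)} {n : ℕ} {ε ε' : ℤ}

lemma HasFormal.conormal (hU : RelOpen U) (h : HasFormal U f F) : Conormal U 0 f := by
  obtain ⟨a, ha⟩ := h.no_log_zero
  refine ((h.remainder 0).add hU (conormal_comp_tang hU a.2)).congr hU fun z _ => ?_
  simp [partialSum_zero_eq ha]

lemma conormal_partialSum (hU : RelOpen U) {a : CoefRing (bdry d U)}
    (h : PowerSeries.coeff 0 F = Polynomial.C a) (N : ℕ) : Conormal U 0 (partialSum F N) := by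
  have : Conormal U 0 (fun z => ∑ k ∈ Finset.range N,
      evalLog (bdry d U) z (PowerSeries.coeff (k + 1) F) * z 0 ^ (k + 1)) :=
    Conormal.sum hU _ fun k _ => (conormal_term hU _ k).mono (Nat.zero_le _)
  refine (this.add hU (conormal_comp_tang hU a.2)).congr hU fun z _ => ?_
  simp [partialSum, h, Finset.sum_range_succ' _ N, -PowerSeries.coeff_zero_eq_constantCoeff]

lemma HasFormal.tendsto (hU : RelOpen U) (h : HasFormal U f F) {a : CoefRing (bdry d U)}
    (ha : PowerSeries.coeff 0 F = Polynomial.C a) {z₀ : E d} (hz : z₀ ∈ U) (h0 : z₀ 0 = 0) :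
    Tendsto f (𝓝[collar U] z₀) (𝓝 ((a : EuclideanSpace ℝ (Fin d) → ℝ) (tang z₀))) := by
  -- The remainder for N = 0 is merely bounded; N = 1 is the first one that tends to 0.
  have h1 : Tendsto (fun z => f z - partialSum F 1 z) (𝓝[collar U] z₀) (𝓝 0) := by
    refine ((h.remainder 1).base.2 z₀ hz h0).trans_tendsto ?_
    have : Tendsto (fun z : E d => z 0 ^ 1) (𝓝 z₀) (𝓝 (z₀ 0 ^ 1)) :=
      Continuous.tendsto (by fun_prop) z₀
    rw [h0] at this
    simpa using this.mono_left nhdsWithin_le_nhds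
  have h2 := tendsto_term hU (PowerSeries.coeff 1 F) hz h0
  have h3 : Tendsto (fun z => (a : EuclideanSpace ℝ (Fin d) → ℝ) (tang z)) (𝓝[collar U] z₀)
      (𝓝 ((a : EuclideanSpace ℝ (Fin d) → ℝ) (tang z₀))) := by
    have h1 : ContinuousAt (a : EuclideanSpace ℝ (Fin d) → ℝ) (tang z₀) :=
      a.2.continuousOn.continuousAt (hU.isOpen_bdry.mem_nhds (tang_mem_bdry hz h0))
    exact (h1.tendsto.comp (continuous_tang.tendsto z₀)).mono_left nhdsWithin_le_nhds
  have h4 := (h1.add h2).add h3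
  simp only [add_zero, zero_add] at h4
  refine h4.congr fun z => ?_
  simp [partialSum, Finset.sum_range_succ, ha, -PowerSeries.coeff_zero_eq_constantCoeff]
  ring

lemma HasFormal.add (hU : RelOpen U) (hf : HasFormal U f F) (hg : HasFormal U g G) :
    HasFormal U (fun z => f z + g z) (F + G) := by
  obtain ⟨a, ha⟩ := hf.no_log_zero
  obtain ⟨b, hb⟩ := hg.no_log_zero
  refine ⟨hf.smooth.add hg.smooth, ⟨a + b, by rw [map_add, ha, hb, map_add]⟩, fun N => ?_⟩
  refine ((hf.remainder N).add hU (hg.remainder N)).congr hU fun z _ => ?_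
  simp only [partialSum_add]; ring

lemma HasFormal.mul (hU : RelOpen U) (hf : HasFormal U f F) (hg : HasFormal U g G) :
    HasFormal U (fun z => f z * g z) (F * G) := by
  obtain ⟨a, ha⟩ := hf.no_log_zero
  obtain ⟨b, hb⟩ := hg.no_log_zero
  refine ⟨hf.smooth.mul hg.smooth, ⟨a * b, ?_⟩, fun N => ?_⟩
  · simp only [PowerSeries.coeff_zero_eq_constantCoeff] at ha hb ⊢
    rw [map_mul, map_mul, ← ha, ← hb]
  -- fg - (FG)_N = (f - F_N) g + F_N (g - G_N) + (F_N G_N - (FG)_N).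
  · have h1 := (hf.remainder N).mul hU (hg.conormal hU)
    have h2 := (conormal_partialSum hU ha N).mul hU (hg.remainder N)
    rw [zero_add] at h2
    refine ((h1.add hU h2).add hU (conormal_partialSum_mul hU F G N)).congr hU fun z _ => ?_
    ring

lemma hasFormal_const (hU : RelOpen U) (c : ℝ) : HasFormal U (fun _ => c)
    (PowerSeries.C (Polynomial.C (algebraMap ℝ (CoefRing (bdry d U)) c))) := by
  refine ⟨contDiffOn_const, ⟨algebraMap ℝ _ c, by simp⟩, fun N => ?_⟩
  refine Conormal.congr hU (fun j => ConormalUpTo.zero hU j) fun z _ => ?_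
  rw [partialSum_C, evalLog_C]
  exact (sub_self c).symm

lemma hasFormal_normal (hU : RelOpen U) :
    HasFormal U (fun z => z 0) (PowerSeries.X : Formal (bdry d U)) := by
  refine ⟨by fun_prop, ⟨0, by simp⟩, fun N => ?_⟩
  cases N with
  | zero => simpa [partialSum_X_zero] using (conormal_normal hU).mono (Nat.zero_le 1)
  | succ N =>
    exact Conormal.congr hU (fun j => ConormalUpTo.zero hU j) fun z _ => by
      simp [partialSum_X_succ]

lemma HasFormal.inv_of_mul_eq_one (hU : RelOpen U) (hf : HasFormal U f F) (hFG : F * G = 1)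
    (h0 : ∀ z ∈ interiorPart d U, f z ≠ 0) {a b : CoefRing (bdry d U)}
    (ha : PowerSeries.coeff 0 F = Polynomial.C a) (hb : PowerSeries.coeff 0 G = Polynomial.C b)
    (hne : ∀ y ∈ bdry d U, (a : EuclideanSpace ℝ (Fin d) → ℝ) y ≠ 0) :
    HasFormal U (fun z => (f z)⁻¹) G := by
  refine ⟨hf.smooth.inv h0, ⟨b, hb⟩, fun N => ?_⟩
  have hinv : Conormal U 0 (fun z => (f z)⁻¹) :=
    (hf.conormal hU).inv hU (fun z hz => h0 z hz.1) fun z₀ hz hz0 =>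
      ((hf.tendsto hU ha hz hz0).inv₀ (hne _ (tang_mem_bdry hz hz0))).isBigO_one ℝ
  -- With (FG)_N = 1: 1/f - G_N = -f⁻¹ ((f - F_N) G_N + (F_N G_N - 1)).
  have h1 := (hf.remainder N).mul hU (conormal_partialSum hU hb N)
  have h2 := hinv.mul hU (h1.add hU (conormal_partialSum_mul hU F G N))
  rw [zero_add, add_zero] at h2
  refine (h2.const_mul hU (-1)).congr hU fun z hz => ?_
  have h3 : partialSum (F * G) N z = 1 := by
    rw [hFG, show (1 : Formal (bdry d U)) = PowerSeries.C 1 by simp, partialSum_C, map_one]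
  have := h0 z hz.1
  simp only [h3]
  field_simp
  ring

/-! ### Functions with parity -/

lemma contDiffOn_phgSum {a : ℕ → ℕ → EuclideanSpace ℝ (Fin d) → ℝ} {Q : ℕ → ℕ}
    (ha : ∀ k q, q ≤ Q k → ContDiffOn ℝ ∞ (a k q) (bdry d U)) (N : ℕ) :
    ContDiffOn ℝ ∞ (phgSum a Q N) (collar U) := by
  unfold phgSum
  refine ContDiffOn.sum fun k _ => ContDiffOn.sum fun q hq => ?_
  have h1 : ContDiffOn ℝ ∞ (fun z : E d => a k q (tang z)) (collar U) :=
    (ha k q (by simpa [Nat.lt_succ_iff] using hq)).comp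
      (tangL d).contDiff.contDiffOn fun z hz => hz.2
  have h2 : ContDiffOn ℝ ∞ (fun z : E d => z 0) (collar U) := by fun_prop
  exact (h1.mul (h2.pow k)).mul ((h2.log fun z hz => (pos_of_mem_collar hz).ne').pow q)

/-- The dictionary that lets ring operations on power series replace manipulation of coefficient
families. -/
lemma parityBelow_iff (hU : RelOpen U) :
    ParityBelow U n ε f ↔ ∃ F, HasFormal U f F ∧ FormalParity n ε F := by
  constructor
  · rintro ⟨a, Q, h, hpar⟩
    classical
    have hz : ∀ k q, ¬ ((k = 0 ∧ q ≠ 0) ∨ (k < n ∧ (q ≠ 0 ∨ (-1 : ℤ) ^ k ≠ ε)) ∨ Q k < q) →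
        q ≤ Q k := fun k q hkq => by
      by_contra hc
      exact hkq (Or.inr (Or.inr (by omega)))
    -- Elements of `CoefRing` are functions on all of ℝ^d, while the given coefficients vanish only
    -- on `bdry d U`. The forbidden ones are replaced by an honest zero, as are those beyond the log
    -- degree `Q k`, which need not be smooth.
    let a' : ℕ → ℕ → CoefRing (bdry d U) := fun k q =>
      if hkq : (k = 0 ∧ q ≠ 0) ∨ (k < n ∧ (q ≠ 0 ∨ (-1 : ℤ) ^ k ≠ ε)) ∨ Q k < q then 0
      else ⟨a k q, h.smooth_coeff k q (hz k q hkq)⟩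
    have ha' : ∀ k q, q ≤ Q k → ∀ y ∈ bdry d U,
        (a' k q : EuclideanSpace ℝ (Fin d) → ℝ) y = a k q y := by
      intro k q hq y hy
      simp only [a']
      split_ifs with hkq
      · rcases hkq with ⟨rfl, hq0⟩ | ⟨hk, hkq⟩ | hlt
        · exact (h.no_log_zero q hq hq0 y hy).symm
        · exact (hpar k hk q hq hkq y hy).symm
        · omega
      · rfl
    let F : Formal (bdry d U) := PowerSeries.mk fun k =>
      ∑ q ∈ Finset.range (Q k + 1), Polynomial.monomial q (a' k q)
    have hF : ∀ k, PowerSeries.coeff k F =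
        ∑ q ∈ Finset.range (Q k + 1), Polynomial.monomial q (a' k q) := fun k => by
      simp [F]
    have hFC : ∀ k, (k = 0 ∨ k < n) → PowerSeries.coeff k F = Polynomial.C (a' k 0) := by
      intro k hk
      rw [hF, Finset.sum_eq_single 0]
      · rfl
      · intro q _ hq
        have : a' k q = 0 := by
          refine dif_pos ?_
          rcases hk with hk | hk
          · exact Or.inl ⟨hk, hq⟩
          · exact Or.inr (Or.inl ⟨hk, Or.inl hq⟩)
        rw [this, map_zero]
      · simp
    have hsum : ∀ N, ∀ z ∈ collar U, phgSum a Q N z = partialSum F N z := fun N z hz => by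
      unfold phgSum partialSum
      refine Finset.sum_congr rfl fun k _ => ?_
      rw [hF, map_sum, Finset.sum_mul]
      refine Finset.sum_congr rfl fun q hq => ?_
      simp only [evalLog, Polynomial.coe_eval₂RingHom, Polynomial.eval₂_monomial, evalCoef_apply]
      rw [ha' k q (by simpa [Nat.lt_succ_iff] using hq) _ hz.2]
      ring
    refine ⟨F, ⟨h.smooth, ⟨_, hFC 0 (Or.inl rfl)⟩, fun N => ?_⟩, fun k hk =>
      ⟨_, hFC k (Or.inr hk), fun hε => dif_pos (Or.inr (Or.inl ⟨hk, Or.inr hε⟩))⟩⟩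
    refine Conormal.congr hU (f := fun z => f z - phgSum a Q N z) ?_
      fun z hz => by simp only [hsum N z hz]
    refine (conormal_iff_foldr hU).2 ⟨?_, fun L z₀ hz h0 => ?_⟩
    · exact (h.smooth.mono collar_subset).sub (contDiffOn_phgSum h.smooth_coeff N)
    · rw [hU.nhdsWithin_collar hz h0]
      exact h.remainder N L z₀ hz h0
  · rintro ⟨F, h, hpar⟩
    refine ⟨fun k q => ((PowerSeries.coeff k F).coeff q : CoefRing (bdry d U)),
      fun k => (PowerSeries.coeff k F).natDegree, ⟨h.smooth, 
      fun k q _ => ((PowerSeries.coeff k F).coeff q).2, ?_,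
        fun N L z₀ hz h0 => ?_⟩, ?_⟩
    · intro q _ hq y _
      obtain ⟨a, ha⟩ := h.no_log_zero
      simp only [ha, Polynomial.coeff_C, if_neg hq]
      rfl
    · have := (conormal_iff_foldr hU).1 (h.remainder N)
      rw [← hU.nhdsWithin_collar hz h0]
      convert this.2 L z₀ hz h0 using 3 with z
      congr 1
      unfold phgSum partialSum
      refine Finset.sum_congr rfl fun k _ => ?_
      rw [evalLog_eq_sum, Finset.sum_mul]
      exact Finset.sum_congr rfl fun q _ => by ring
    · intro k hk q _ hq y _
      obtain ⟨a, ha, ha'⟩ := hpar k hk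
      simp only [ha, Polynomial.coeff_C]
      rcases hq with hq | hq
      · rw [if_neg hq]; rfl
      · rw [ha' hq]; simp

lemma ParityBelow.smooth (h : ParityBelow U n ε f) : ContDiffOn ℝ ∞ f (interiorPart d U) := by
  obtain ⟨_, _, h, _⟩ := h; exact h.smooth

lemma ParityBelow.congr (hU : RelOpen U) (h : ParityBelow U n ε f)
    (hfg : EqOn f g (interiorPart d U)) : ParityBelow U n ε g := by
  obtain ⟨F, hF, hpar⟩ := (parityBelow_iff hU).1 h
  refine (parityBelow_iff hU).2 ⟨F, ⟨hF.smooth.congr fun z hz => (hfg hz).symm, hF.no_log_zero,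
    fun N => (hF.remainder N).congr hU fun z hz => ?_⟩, hpar⟩
  simp only [hfg hz.1]

lemma ParityBelow.add (hU : RelOpen U) (hf : ParityBelow U n ε f) (hg : ParityBelow U n ε g) :
    ParityBelow U n ε (fun z => f z + g z) := by
  obtain ⟨F, hF, hF'⟩ := (parityBelow_iff hU).1 hf
  obtain ⟨G, hG, hG'⟩ := (parityBelow_iff hU).1 hg
  exact (parityBelow_iff hU).2 ⟨F + G, hF.add hU hG, hF'.add hG'⟩

lemma ParityBelow.mul (hU : RelOpen U) (hf : ParityBelow U n ε f) (hg : ParityBelow U n ε' g) :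
    ParityBelow U n (ε * ε') (fun z => f z * g z) := by
  obtain ⟨F, hF, hF'⟩ := (parityBelow_iff hU).1 hf
  obtain ⟨G, hG, hG'⟩ := (parityBelow_iff hU).1 hg
  exact (parityBelow_iff hU).2 ⟨F * G, hF.mul hU hG, hF'.mul hG'⟩

lemma parityBelow_const (hU : RelOpen U) (c : ℝ) : ParityBelow U n 1 (fun _ => c) := by
  refine (parityBelow_iff hU).2 ⟨_, hasFormal_const hU c, fun k _ => ?_⟩
  rcases eq_or_ne k 0 with rfl | hk
  · exact ⟨algebraMap ℝ _ c, by simp⟩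
  · exact ⟨0, by simp [PowerSeries.coeff_C, hk]⟩

lemma parityBelow_zero (hU : RelOpen U) : ParityBelow U n ε (fun _ => 0) := by
  refine (parityBelow_iff hU).2 ⟨_, hasFormal_const hU 0, fun k _ => ⟨0, by simp⟩⟩

lemma parityBelow_normal (hU : RelOpen U) : ParityBelow U n (-1) (fun z => z 0) := by
  refine (parityBelow_iff hU).2 ⟨_, hasFormal_normal hU, fun k _ => ?_⟩
  rcases eq_or_ne k 1 with rfl | hk
  · exact ⟨1, by simp⟩
  · exact ⟨0, by simp [PowerSeries.coeff_X, hk]⟩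

lemma ParityBelow.const_mul (hU : RelOpen U) (c : ℝ) (hf : ParityBelow U n ε f) :
    ParityBelow U n ε (fun z => c * f z) := by
  simpa using (parityBelow_const hU c).mul hU hf

lemma ParityBelow.sub (hU : RelOpen U) (hf : ParityBelow U n ε f) (hg : ParityBelow U n ε g) :
    ParityBelow U n ε (fun z => f z - g z) :=
  (hf.add hU (hg.const_mul hU (-1))).congr hU fun z _ => by ring

lemma ParityBelow.sum (hU : RelOpen U) {ι : Type*} (S : Finset ι) {f : ι → E d → ℝ}
    (h : ∀ i ∈ S, ParityBelow U n ε (f i)) : ParityBelow U n ε (fun z => ∑ i ∈ S, f i z) := by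
  classical
  induction S using Finset.induction_on with
  | empty => simpa using parityBelow_zero hU
  | insert i S hi ih =>
    simp only [Finset.sum_insert hi]
    exact (h i (Finset.mem_insert_self _ _)).add hU
      (ih fun k hk => h k (Finset.mem_insert_of_mem hk))

lemma ParityBelow.prod (hU : RelOpen U) {ι : Type*} (S : Finset ι) {f : ι → E d → ℝ} {ε : ι → ℤ}
    (h : ∀ i ∈ S, ParityBelow U n (ε i) (f i)) :
    ParityBelow U n (∏ i ∈ S, ε i) (fun z => ∏ i ∈ S, f i z) := by
  classical
  induction S using Finset.induction_on with
  | empty => simpa using parityBelow_const hU 1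
  | insert i S hi ih =>
    simp only [Finset.prod_insert hi]
    exact (h i (Finset.mem_insert_self _ _)).mul hU
      (ih fun k hk => h k (Finset.mem_insert_of_mem hk))

/-- A unit of `CoefRing B` must be nonzero off B as well, so the value there is reset to 1. -/
lemma exists_unit_eqOn (a : CoefRing B)
    (hne : ∀ y ∈ B, (a : EuclideanSpace ℝ (Fin d) → ℝ) y ≠ 0) :
    ∃ a' b : CoefRing B, a' * b = 1 ∧ EqOn (a' : EuclideanSpace ℝ (Fin d) → ℝ) a B := by
  classical
  refine ⟨⟨fun y => if y ∈ B then (a : EuclideanSpace ℝ (Fin d) → ℝ) y else 1,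
      ContDiffOn.congr a.2 fun y hy => if_pos hy⟩,
    ⟨fun y => if y ∈ B then ((a : EuclideanSpace ℝ (Fin d) → ℝ) y)⁻¹ else 1,
      ContDiffOn.congr (ContDiffOn.inv a.2 hne) fun y hy => if_pos hy⟩, ?_, fun y hy => if_pos hy⟩
  refine Subtype.ext (funext fun y => ?_)
  by_cases hy : y ∈ B
  · simp [hy, hne y hy]
  · simp [hy]

/-- The reciprocal of an even function that does not vanish, not even at the boundary. -/
lemma ParityBelow.inv (hU : RelOpen U) (hf : ParityBelow U n 1 f)
    (h0 : ∀ z ∈ interiorPart d U, f z ≠ 0)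
    (hb : ∀ z₀ ∈ U, z₀ 0 = 0 → ∃ c ≠ 0, Tendsto f (𝓝[interiorPart d U] z₀) (𝓝 c)) :
    ParityBelow U n 1 (fun z => (f z)⁻¹) := by
  obtain ⟨F, hF, hpar⟩ := (parityBelow_iff hU).1 hf
  obtain ⟨a, ha⟩ := hF.no_log_zero
  have hne : ∀ y ∈ bdry d U, (a : EuclideanSpace ℝ (Fin d) → ℝ) y ≠ 0 := by
    rintro y ⟨z₀, hz, hz0, rfl⟩
    obtain ⟨c, hc, hlim⟩ := hb z₀ hz hz0
    -- The leading coefficient is the boundary value of f, by uniqueness of limits.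
    have h1 := hF.tendsto hU ha hz hz0
    rw [hU.nhdsWithin_collar hz hz0] at h1
    have := hU.neBot hz hz0
    rwa [tendsto_nhds_unique h1 hlim]
  obtain ⟨a', b, hab, ha'⟩ := exists_unit_eqOn a hne
  -- F' differs from F only in its constant term, and there only off `bdry d U`. It still expands f,
  -- but is now invertible.
  set F' : Formal (bdry d U) := F + PowerSeries.C (Polynomial.C (a' - a)) with hF'
  have hF'0 : PowerSeries.coeff 0 F' = Polynomial.C a' := by
    rw [hF', map_add, ha]; simp
  have hF'k : ∀ k, k ≠ 0 → PowerSeries.coeff k F' = PowerSeries.coeff k F := fun k hk => by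
    rw [hF', map_add, PowerSeries.coeff_C, if_neg hk, add_zero]
  have hfF' : HasFormal U f F' := by
    refine ⟨hF.smooth, ⟨a', hF'0⟩, fun N => (hF.remainder N).congr hU fun z hz => ?_⟩
    simp only [hF', partialSum_add, partialSum_C, evalLog_C]
    have := ha' hz.2
    simp [this]
  have hpar' : FormalParity n 1 F' := fun k hk => by
    rcases eq_or_ne k 0 with rfl | hk0
    · exact ⟨a', hF'0, by simp⟩
    · rw [hF'k k hk0]; exact hpar k hk
  obtain ⟨G, hmul, hG⟩ := exists_mul_eq_one hF'0 hab
  refine (parityBelow_iff hU).2 ⟨G, hfF'.inv_of_mul_eq_one hU hmul h0 hF'0 hG fun y hy => ?_,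
    hpar'.of_mul_eq_one hmul hF'0 (b := b) (by rw [mul_comm, hab])⟩
  rw [ha' hy]
  exact hne y hy

/-- The coefficients of the derivative of an expansion along `x ∂_x` or `∂_y`. -/
def derivCoeff (a : ℕ → ℕ → EuclideanSpace ℝ (Fin d) → ℝ) (Q : ℕ → ℕ) (s : Fin (d + 1))
    (k q : ℕ) (y : EuclideanSpace ℝ (Fin d)) : ℝ :=
  fderiv ℝ (a k q) y (tang (EuclideanSpace.single s (1 : ℝ))) + if s = 0 then
    k * a k q y + (if q + 1 ≤ Q k then (q + 1) * a k (q + 1) y else 0) else 0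

lemma bDeriv_phgTerm {a : EuclideanSpace ℝ (Fin d) → ℝ} {z : E d}
    (ha : DifferentiableAt ℝ a (tang z)) (hz : 0 < z 0) (k q : ℕ) (s : Fin (d + 1)) :
    bDeriv s (fun z => a (tang z) * z 0 ^ k * Real.log (z 0) ^ q) z
      = fderiv ℝ a (tang z) (tang (EuclideanSpace.single s (1 : ℝ))) * z 0 ^ k
          * Real.log (z 0) ^ q
        + if s = 0 then k * a (tang z) * z 0 ^ k * Real.log (z 0) ^ q
          + q * a (tang z) * z 0 ^ k * Real.log (z 0) ^ (q - 1) else 0 := by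
  have h1 : DifferentiableAt ℝ (fun z => a (tang z)) z :=
    DifferentiableAt.comp z (g := a) (f := tangL d) ha (tangL d).differentiableAt
  have h2 : HasDerivAt (fun t : ℝ => t ^ k * Real.log t ^ q)
      (k * z 0 ^ (k - 1) * Real.log (z 0) ^ q
        + z 0 ^ k * (q * Real.log (z 0) ^ (q - 1) * (z 0)⁻¹)) (z 0) :=
    (hasDerivAt_pow k (z 0)).mul ((Real.hasDerivAt_log hz.ne').pow q)
  have h3 : DifferentiableAt ℝ (fun z : E d => z 0 ^ k * Real.log (z 0) ^ q) z := by
    have h3 := h2.comp_hasFDerivAt z (hasFDerivAt_normal z)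
    exact h3.differentiableAt
  have h4 := pd_mul h1 h3 s
  simp only [← mul_assoc] at h4
  rw [bDeriv_eq, h4, pd_comp_tang ha,
    pd_normal (φ := fun t => t ^ k * Real.log t ^ q) h2]
  by_cases hs : s = 0
  · subst hs
    rcases k with _ | k
    · simp [bWeight, tang_single_zero]
      field_simp
    · simp [bWeight, tang_single_zero]
      field_simp
      ring
  · simp [bWeight, hs]

lemma bDeriv_phgSum (hU : RelOpen U) {a : ℕ → ℕ → EuclideanSpace ℝ (Fin d) → ℝ} {Q : ℕ → ℕ}
    (ha : ∀ k q, q ≤ Q k → ContDiffOn ℝ ∞ (a k q) (bdry d U)) (N : ℕ) (s : Fin (d + 1)) {z : E d}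
    (hz : z ∈ collar U) :
    bDeriv s (phgSum a Q N) z = phgSum (derivCoeff a Q s) Q N z := by
  have hd : ∀ k q, q ≤ Q k → DifferentiableAt ℝ (a k q) (tang z) := fun k q hq =>
    differentiableAt_of_contDiffOn hU.isOpen_bdry (ha k q hq) hz.2
  have hdt : ∀ k q, q ≤ Q k →
      DifferentiableAt ℝ (fun z => a k q (tang z) * z 0 ^ k * Real.log (z 0) ^ q) z := by
    intro k q hq
    have h1 : DifferentiableAt ℝ (fun z => a k q (tang z)) z :=
      DifferentiableAt.comp z (g := a k q) (f := tangL d) (hd k q hq) (tangL d).differentiableAt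
    have h2 : DifferentiableAt ℝ (fun z : E d => z 0) z := (hasFDerivAt_normal z).differentiableAt
    exact (h1.mul (h2.pow k)).mul ((h2.log (pos_of_mem_collar hz).ne').pow q)
  unfold phgSum
  rw [bDeriv_eq, pd_sum _ fun k _ => DifferentiableAt.fun_sum fun q hq =>
    hdt k q (by simpa [Nat.lt_succ_iff] using hq), Finset.mul_sum]
  refine Finset.sum_congr rfl fun k _ => ?_
  rw [pd_sum _ fun q hq => hdt k q (by simpa [Nat.lt_succ_iff] using hq), Finset.mul_sum]
  have h1 : ∀ q ∈ Finset.range (Q k + 1), bWeight s z *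
      pd s (fun z => a k q (tang z) * z 0 ^ k * Real.log (z 0) ^ q) z
      = fderiv ℝ (a k q) (tang z) (tang (EuclideanSpace.single s (1 : ℝ))) * z 0 ^ k
          * Real.log (z 0) ^ q
        + (if s = 0 then k * a k q (tang z) * z 0 ^ k * Real.log (z 0) ^ q else 0)
        + (if s = 0 then q * a k q (tang z) * z 0 ^ k * Real.log (z 0) ^ (q - 1) else 0) := by
    intro q hq
    rw [← bDeriv_eq, bDeriv_phgTerm (hd k q (by simpa [Nat.lt_succ_iff] using hq))
      (pos_of_mem_collar hz)]
    split_ifs <;> ring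
  have h2 : ∀ q ∈ Finset.range (Q k + 1),
      derivCoeff a Q s k q (tang z) * z 0 ^ k * Real.log (z 0) ^ q
      = fderiv ℝ (a k q) (tang z) (tang (EuclideanSpace.single s (1 : ℝ))) * z 0 ^ k
          * Real.log (z 0) ^ q
        + (if s = 0 then k * a k q (tang z) * z 0 ^ k * Real.log (z 0) ^ q else 0)
        + (if s = 0 then (if q + 1 ≤ Q k then
          (q + 1) * a k (q + 1) (tang z) * z 0 ^ k * Real.log (z 0) ^ q else 0) else 0) := by
    intro q _
    unfold derivCoeff
    split_ifs <;> ring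
  rw [Finset.sum_congr rfl h1, Finset.sum_congr rfl h2, Finset.sum_add_distrib,
    Finset.sum_add_distrib (f := fun q => fderiv ℝ (a k q) (tang z)
      (tang (EuclideanSpace.single s (1 : ℝ))) * z 0 ^ k * Real.log (z 0) ^ q
        + (if s = 0 then k * a k q (tang z) * z 0 ^ k * Real.log (z 0) ^ q else 0))]
  congr 1
  split_ifs
  -- Differentiating log^q lowers q, so the sums match after a shift: the term q = 0 drops on the
  -- left, and q = `Q k` on the right.
  · rw [Finset.sum_range_succ', Finset.sum_range_succ]
    simp only [Nat.cast_zero, zero_mul, add_zero]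
    rw [if_neg (by omega), add_zero]
    refine Finset.sum_congr rfl fun q hq => ?_
    rw [if_pos (by simpa using hq)]
    simp
  · simp

/-- Neither x ∂_x nor ∂_y changes an exponent of x, and x ∂_x only lowers powers of log x. No new
exponents or logarithms can appear below x^n. -/
lemma ParityBelow.bDeriv (hU : RelOpen U) (hf : ParityBelow U n ε f) (s : Fin (d + 1)) :
    ParityBelow U n ε (bDeriv s f) := by
  obtain ⟨a, Q, h, hpar⟩ := hf
  have hfd : ∀ {k q} {y : EuclideanSpace ℝ (Fin d)}, y ∈ bdry d U →
      (∀ y ∈ bdry d U, a k q y = 0) → fderiv ℝ (a k q) y = 0 := fun {k q y} hy h0 => by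
    have : a k q =ᶠ[𝓝 y] fun _ => 0 := eventually_of_mem (hU.isOpen_bdry.mem_nhds hy) h0
    rw [this.fderiv_eq]; simp
  refine ⟨derivCoeff a Q s, Q, ⟨ContDiffOn.bDeriv hU.isOpen_interiorPart h.smooth s, ?_, ?_, ?_⟩,
    ?_⟩
  · intro k q hq
    refine ((((h.smooth_coeff k q hq).fderiv_of_isOpen hU.isOpen_bdry (m := ∞)
      (by simp)).clm_apply contDiffOn_const).add ?_)
    split_ifs with hs hq'
    · exact (contDiffOn_const.mul (h.smooth_coeff k q hq)).add
        (contDiffOn_const.mul (h.smooth_coeff k _ hq'))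
    · exact (contDiffOn_const.mul (h.smooth_coeff k q hq)).add contDiffOn_const
    · exact contDiffOn_const
  · intro q hq hq0 y hy
    unfold derivCoeff
    rw [hfd hy (h.no_log_zero q hq hq0), h.no_log_zero q hq hq0 y hy]
    by_cases hq' : q + 1 ≤ Q 0
    · simp [h.no_log_zero (q + 1) hq' (by omega) y hy]
    · simp [hq']
  · intro N L z₀ hz h0
    -- Appending s makes it the first derivative applied, so this is L applied to the differentiated
    -- remainder.
    have h1 := h.remainder N (L ++ [s]) z₀ hz h0
    simp only [List.foldr_append, List.foldr_cons, List.foldr_nil] at h1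
    refine h1.congr' ?_ EventuallyEq.rfl
    have hfold : ∀ (L : List (Fin (d + 1))) {u v : E d → ℝ}, EqOn u v (collar U) →
        EqOn (L.foldr AH.bDeriv u) (L.foldr AH.bDeriv v) (collar U) := by
      intro L u v huv
      induction L with
      | nil => exact huv
      | cons t L ih => exact bDeriv_congr hU.isOpen_collar ih t
    rw [← hU.nhdsWithin_collar hz h0]
    refine eventually_of_mem self_mem_nhdsWithin (hfold L fun z hz => ?_)
    rw [← bDeriv_phgSum hU h.smooth_coeff N s hz, bDeriv_eq, bDeriv_eq, bDeriv_eq,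
      pd_sub (differentiableAt_of_contDiffOn hU.isOpen_interiorPart h.smooth hz.1)
        (differentiableAt_of_contDiffOn hU.isOpen_collar (contDiffOn_phgSum h.smooth_coeff N) hz), mul_sub]
  · intro k hk q hq hkq y hy
    unfold derivCoeff
    rw [hfd hy (hpar k hk q hq hkq), hpar k hk q hq hkq y hy]
    by_cases hq' : q + 1 ≤ Q k
    · simp [hpar k hk (q + 1) hq' (Or.inl (by omega)) y hy]
    · simp [hq']

end AH
end

/-! ### Reflection signs of the curvature tensor. -/

noncomputable section

namespace AH

variable {d : ℕ}

/-! ### Parity of the curvature -/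

/-- The sign of a coordinate under the reflection `x ↦ -x`. -/
def reflSign (s : Fin (d + 1)) : ℤ := if s = 0 then -1 else 1

/-- This makes the sign of a summed index disappear, in every contraction below. -/
lemma reflSign_mul_self (s : Fin (d + 1)) : reflSign s * reflSign s = 1 := by
  unfold reflSign; split_ifs <;> norm_num

lemma prod_reflSign {k : ℕ} (J : Fin k → Fin (d + 1)) :
    ∏ i, reflSign (J i) = (-1) ^ numNormal J := by
  simp [reflSign, numNormal, Finset.prod_ite]

variable {U : Set (E d)} {n : ℕ} {ε ε' : ℤ} {f g : E d → ℝ}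

lemma ParityBelow.congr_sign (hU : RelOpen U) (h : ParityBelow U n ε f) (hε : ε = ε')
    (hfg : ∀ z ∈ interiorPart d U, g z = f z) : ParityBelow U n ε' g :=
  hε ▸ h.congr hU fun z hz => (hfg z hz).symm

lemma ParityBelow.det (hU : RelOpen U) {ι : Type*} [Fintype ι] [DecidableEq ι]
    {A : E d → Matrix ι ι ℝ} (hA : ∀ i j, ParityBelow U n 1 (fun z => A z i j)) :
    ParityBelow U n 1 (fun z => (A z).det) := by
  have : ParityBelow U n 1 (fun z => ∑ τ : Equiv.Perm ι,
      ((Equiv.Perm.sign τ : ℤ) : ℝ) * ∏ i, A z (τ i) i) :=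
    ParityBelow.sum hU _ fun τ _ => ParityBelow.const_mul hU _ (by
      simpa using ParityBelow.prod hU Finset.univ (ε := fun _ => 1) fun i _ => hA (τ i) i)
  exact this.congr hU fun z _ => (Matrix.det_apply' _).symm

/-- Cramer's rule: cofactors are polynomial in even entries, and the determinant is inverted as an
even function. -/
lemma ParityBelow.matrix_inv (hU : RelOpen U) {ι : Type*} [Fintype ι] [DecidableEq ι]
    {A : E d → Matrix ι ι ℝ} (hA : ∀ i j, ParityBelow U n 1 (fun z => A z i j))
    (h0 : ∀ z ∈ interiorPart d U, (A z).det ≠ 0)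
    (hb : ∀ z₀ ∈ U, z₀ 0 = 0 →
      ∃ c ≠ 0, Tendsto (fun z => (A z).det) (𝓝[interiorPart d U] z₀) (𝓝 c)) (i j : ι) :
    ParityBelow U n 1 (fun z => (A z)⁻¹ i j) := by
  have hadj : ParityBelow U n 1 (fun z => (A z).adjugate i j) := by
    simp only [Matrix.adjugate_apply]
    refine ParityBelow.det hU fun k l => ?_
    by_cases hk : k = j
    · subst hk
      simpa only [Matrix.updateRow_self] using parityBelow_const hU _
    · simpa only [Matrix.updateRow_ne hk] using hA k l
  refine (((ParityBelow.det hU hA).inv hU h0 hb).mul hU hadj).congr_sign hU (one_mul 1)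
    fun z _ => ?_
  simp [Matrix.inv_def]

/-- The parity of the components of a block diagonal matrix. -/
lemma parityBelow_of_block (hU : RelOpen U) {A : MetricField d}
    (hA : ∀ s t, ParityBelow U n 1 (fun z => A z s t))
    (h0 : ∀ z ∈ interiorPart d U, ∀ s t, (s = 0 ↔ ¬ t = 0) → A z s t = 0) (s t : Fin (d + 1)) :
    ParityBelow U n (reflSign s * reflSign t) (fun z => A z s t) := by
  -- A mixed component is zero, which has either parity; for the others the two signs multiply to 1.
  by_cases h : s = 0 ↔ ¬ t = 0
  · exact (parityBelow_zero hU).congr_sign hU rfl fun z hz => h0 z hz s t h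
  · refine (hA s t).congr_sign hU ?_ fun _ _ => rfl
    unfold reflSign
    by_cases hs : s = 0 <;> by_cases ht : t = 0 <;> simp_all

/-- `G = x^{-2} H` on the interior part of `U`, and the components of `H` and `H⁻¹` have the parity
below `x^n` of a tensor that is invariant under the reflection `x ↦ -x`. -/
structure IsConformalEven (U : Set (E d)) (n : ℕ) (G H : MetricField d) : Prop where
  sq_mul : ∀ z ∈ interiorPart d U, ∀ s t, z 0 ^ 2 * G z s t = H z s t
  inv : ∀ z ∈ interiorPart d U, ∀ s t, (G z)⁻¹ s t = z 0 ^ 2 * (H z)⁻¹ s t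
  parity : ∀ s t, ParityBelow U n (reflSign s * reflSign t) (fun z => H z s t)
  parity_inv : ∀ s t, ParityBelow U n (reflSign s * reflSign t) (fun z => (H z)⁻¹ s t)

/-- Differentiation of a component of weight `k`. -/
lemma ParityBelow.pow_mul_pd (hU : RelOpen U) {k : ℕ}
    (h : ParityBelow U n ε (fun z => z 0 ^ k * f z)) (s : Fin (d + 1)) :
    ParityBelow U n (-(ε * reflSign s)) (fun z => z 0 ^ (k + 1) * pd s f z) := by
  have hf : ∀ z ∈ interiorPart d U, DifferentiableAt ℝ f z := fun z hz => by
    have h1 : ContDiffOn ℝ ∞ (fun z : E d => (z 0 ^ k)⁻¹) (interiorPart d U) :=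
      ContDiffOn.inv (by fun_prop) fun z hz => pow_ne_zero _ hz.2.ne'
    have h2 := (h1.mul h.smooth).congr (f₁ := f) fun z hz => by
      have := hz.2.ne'
      field_simp
    exact differentiableAt_of_contDiffOn hU.isOpen_interiorPart h2 hz
  have hpd : ∀ z ∈ interiorPart d U, z 0 * pd s (fun z => z 0 ^ k * f z) z
      = (if s = 0 then k * (z 0 ^ k * f z) else 0) + z 0 ^ (k + 1) * pd s f z := fun z hz => by
    have h1 : DifferentiableAt ℝ (fun z : E d => z 0 ^ k) z := by fun_prop
    rw [pd_mul h1 (hf z hz), pd_normal (φ := fun t => t ^ k) (hasDerivAt_pow k (z 0))]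
    split_ifs
    · rcases k with _ | k
      · simp
      · simp; ring
    · ring
  -- Normally, x^{k+1} ∂_x f = x ∂_x (x^k f) - k x^k f keeps the sign. Tangentially, the extra
  -- factor x flips it.
  by_cases hs : s = 0
  · refine ((h.bDeriv hU s).sub hU (h.const_mul hU k)).congr_sign hU (by simp [reflSign, hs])
      fun z hz => ?_
    have := hpd z hz
    rw [if_pos hs] at this
    rw [bDeriv_eq, bWeight, if_pos hs, this]
    ring
  · refine ((parityBelow_normal hU).mul hU (h.bDeriv hU s)).congr_sign hU (by simp [reflSign, hs])
      fun z hz => ?_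
    have := hpd z hz
    rw [if_neg hs] at this
    rw [bDeriv_eq, bWeight, if_neg hs, one_mul, this]
    ring

variable {G H : MetricField d}

/-- G⁻¹ carries x², and ∂G needs x³ to become regular, so a single x regularizes Γ. The minus sign
records the one derivative. -/
lemma IsConformalEven.christoffel (hU : RelOpen U) (h : IsConformalEven U n G H)
    (k i j : Fin (d + 1)) :
    ParityBelow U n (-(reflSign k * reflSign i * reflSign j))
      (fun z => z 0 ^ 1 * christoffel G k i j z) := by
  have hG : ∀ i l j, ParityBelow U n (-(reflSign i * reflSign j * reflSign l))
      (fun z => z 0 ^ (2 + 1) * pd l (fun w => G w i j) z) := fun i l j =>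
    ParityBelow.pow_mul_pd hU ((h.parity i j).congr_sign hU rfl fun z hz => h.sq_mul z hz i j) l
  refine ((ParityBelow.sum hU Finset.univ fun l _ => ?_).const_mul hU (1 / 2 : ℝ)).congr_sign hU rfl
    (f := fun z => (1 / 2 : ℝ) * ∑ l, (H z)⁻¹ k l * (z 0 ^ (2 + 1) * pd i (fun w => G w l j) z
      + z 0 ^ (2 + 1) * pd j (fun w => G w l i) z - z 0 ^ (2 + 1) * pd l (fun w => G w i j) z))
    fun z hz => ?_
  · have h1 := (h.parity_inv k l).mul hU (((hG l i j).add hU ((hG l j i).congr_sign hU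
      (by ring) fun _ _ => rfl)).sub hU ((hG i l j).congr_sign hU (by ring) fun _ _ => rfl))
    refine h1.congr_sign hU ?_ fun _ _ => rfl
    linear_combination (-(reflSign k * reflSign i * reflSign j)) * reflSign_mul_self l
  · unfold AH.christoffel
    rw [mul_left_comm, Finset.mul_sum]
    congr 1
    refine Finset.sum_congr rfl fun l _ => ?_
    rw [h.inv z hz]
    ring

lemma IsConformalEven.riemannUp (hU : RelOpen U) (h : IsConformalEven U n G H)
    (s t u v : Fin (d + 1)) :
    ParityBelow U n (reflSign s * reflSign t * reflSign u * reflSign v)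
      (fun z => z 0 ^ 2 * riemannUp G s t u v z) := by
  have hΓ := h.christoffel hU
  have h1 := ((hΓ s v t).pow_mul_pd hU u).congr_sign hU (g := fun z => z 0 ^ (1 + 1) *
    pd u (AH.christoffel G s v t) z) (by ring :
    _ = reflSign s * reflSign t * reflSign u * reflSign v) fun _ _ => rfl
  have h2 := ((hΓ s u t).pow_mul_pd hU v).congr_sign hU (g := fun z => z 0 ^ (1 + 1) *
    pd v (AH.christoffel G s u t) z) (by ring :
    _ = reflSign s * reflSign t * reflSign u * reflSign v) fun _ _ => rfl
  have h3 : ∀ u v w, ParityBelow U n (reflSign s * reflSign t * reflSign u * reflSign v)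
      (fun z => (z 0 ^ 1 * AH.christoffel G s u w z) * (z 0 ^ 1 * AH.christoffel G w v t z)) :=
    fun u v w => ((hΓ s u w).mul hU (hΓ w v t)).congr_sign hU (by
      linear_combination (reflSign s * reflSign u * reflSign v * reflSign t) *
        reflSign_mul_self w) fun _ _ => rfl
  have h4 := ParityBelow.sum hU Finset.univ fun w _ => (h3 u v w).sub hU
    ((h3 v u w).congr_sign hU (by ring) fun _ _ => rfl)
  refine ((h1.sub hU h2).add hU h4).congr_sign hU rfl fun z _ => ?_
  unfold AH.riemannUp
  rw [mul_add, Finset.mul_sum, mul_sub]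
  congr 1
  exact Finset.sum_congr rfl fun w _ => by ring

lemma IsConformalEven.riemann (hU : RelOpen U) (h : IsConformalEven U n G H)
    (s t u v : Fin (d + 1)) :
    ParityBelow U n (reflSign s * reflSign t * reflSign u * reflSign v)
      (fun z => z 0 ^ 4 * riemann G s t u v z) := by
  have h1 := ParityBelow.sum hU Finset.univ fun w _ =>
    ((h.parity s w).mul hU (h.riemannUp hU w t u v)).congr_sign hU (by
      linear_combination (reflSign s * reflSign t * reflSign u * reflSign v) *
        reflSign_mul_self w :
      _ = reflSign s * reflSign t * reflSign u * reflSign v) fun _ _ => rfl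
  refine h1.congr_sign hU rfl fun z hz => ?_
  unfold AH.riemann
  rw [Finset.mul_sum]
  refine Finset.sum_congr rfl fun w _ => ?_
  rw [← h.sq_mul z hz s w]
  ring

/-- Both kinds of terms contribute -σ_α for the new index α. In a Christoffel term, β replaces a
slot of T: Γ supplies the sign of the replaced index, and the two signs of β cancel. -/
lemma IsConformalEven.covDeriv (hU : RelOpen U) (h : IsConformalEven U n G H) {k m : ℕ}
    {T : (Fin k → Fin (d + 1)) → E d → ℝ}
    (hT : ∀ J, ParityBelow U n (ε * ∏ i, reflSign (J i)) (fun z => z 0 ^ m * T J z))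
    (J : Fin (k + 1) → Fin (d + 1)) :
    ParityBelow U n (-ε * ∏ i, reflSign (J i)) (fun z => z 0 ^ (m + 1) * covDeriv G T J z) := by
  have hprod : ∏ i, reflSign (J i) = (∏ i, reflSign (Fin.init J i)) * reflSign (J (Fin.last k)) :=
    Fin.prod_univ_castSucc _
  have h1 := ((hT (Fin.init J)).pow_mul_pd hU (J (Fin.last k))).congr_sign hU
    (g := fun z => z 0 ^ (m + 1) * pd (J (Fin.last k)) (T (Fin.init J)) z)
    (by rw [hprod]; ring : _ = -ε * ∏ i, reflSign (J i)) fun _ _ => rfl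
  have h2 := ParityBelow.sum hU Finset.univ fun (j : Fin k) _ =>
    ParityBelow.sum hU Finset.univ fun (β : Fin (d + 1)) _ =>
    ((h.christoffel hU β (J (Fin.last k)) (Fin.init J j)).mul hU
      (hT (Function.update (Fin.init J) j β))).congr_sign hU
      (g := fun z => (z 0 ^ 1 * AH.christoffel G β (J (Fin.last k)) (Fin.init J j) z) *
        (z 0 ^ m * T (Function.update (Fin.init J) j β) z))
      (by
        have h3 : ∏ i, reflSign (Function.update (Fin.init J) j β i)
            = reflSign β * ∏ i ∈ Finset.univ \ {j}, reflSign (Fin.init J i) := by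
          rw [← Finset.prod_update_of_mem (Finset.mem_univ j)]
          refine Finset.prod_congr rfl fun i _ => ?_
          by_cases hi : i = j
          · subst hi; simp
          · simp [hi]
        have h4 : ∏ i, reflSign (Fin.init J i)
            = reflSign (Fin.init J j) * ∏ i ∈ Finset.univ \ {j}, reflSign (Fin.init J i) := by
          rw [← Finset.prod_update_of_mem (Finset.mem_univ j),
            Function.update_eq_self_iff.2 rfl]
        rw [hprod, h3, h4]
        linear_combination (-(ε * reflSign (J (Fin.last k)) * reflSign (Fin.init J j) *
          ∏ i ∈ Finset.univ \ {j}, reflSign (Fin.init J i))) * reflSign_mul_self β :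
        _ = -ε * ∏ i, reflSign (J i)) fun _ _ => rfl
  refine (h1.sub hU h2).congr_sign hU rfl fun z _ => ?_
  unfold AH.covDeriv
  rw [mul_sub, Finset.mul_sum]
  congr 1
  refine Finset.sum_congr rfl fun j _ => ?_
  rw [Finset.mul_sum]
  exact Finset.sum_congr rfl fun β _ => by ring

lemma IsConformalEven.frameNablaRm (hU : RelOpen U) (h : IsConformalEven U n G H) (p : ℕ)
    (J : Fin (4 + p) → Fin (d + 1)) :
    ParityBelow U n ((-1) ^ p * ∏ i, reflSign (J i)) (frameNablaRm G p J) := by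
  unfold AH.frameNablaRm
  induction p with
  | zero =>
    refine (h.riemann hU (J 0) (J 1) (J 2) (J 3)).congr_sign hU ?_ fun _ _ => rfl
    rw [pow_zero, one_mul]
    exact (Fin.prod_univ_four (fun i : Fin 4 => reflSign (J i))).symm
  | succ p ih =>
    -- The closing `rfl` uses that 4 + (p + 1) is definitionally (4 + p) + 1.
    exact (h.covDeriv hU ih J).congr_sign hU (by rw [pow_succ, mul_neg_one]; rfl) fun _ _ => rfl

/-- The r inverse metrics supply x^{2r}, exactly the frame factors of the 2r slots. Each slot's sign
occurs once from the curvature and once from an inverse metric. -/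
lemma IsConformalEven.fullContraction (hU : RelOpen U) (h : IsConformalEven U n G H) {k r : ℕ}
    (p : Fin k → ℕ) (e : Fin r × Bool ≃ (i : Fin k) × Fin (4 + p i)) :
    ParityBelow U n 1 (fullContraction G p e) := by
  have hcard : ∑ i, (4 + p i) = 2 * r := by
    have := Fintype.card_congr e
    simp only [Fintype.card_prod, Fintype.card_fin, Fintype.card_bool, Fintype.card_sigma] at this
    omega
  have hsign : ∏ i, (-1 : ℤ) ^ p i = 1 := by
    have h1 : ∏ i, (-1 : ℤ) ^ (4 + p i) = 1 := by
      rw [Finset.prod_pow_eq_pow_sum, hcard, pow_mul]; simp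
    simpa [pow_add] using h1
  refine ParityBelow.congr_sign hU (ParityBelow.sum hU Finset.univ
    fun (I : ((i : Fin k) × Fin (4 + p i)) → Fin (d + 1)) _ =>
      ((ParityBelow.prod hU Finset.univ fun i _ =>
          h.frameNablaRm hU (p i) (fun a => I ⟨i, a⟩)).mul hU
        (ParityBelow.prod hU Finset.univ fun j _ =>
          h.parity_inv (I (e (j, false))) (I (e (j, true))))).congr_sign hU (ε' := 1) ?_
            fun _ _ => rfl) rfl fun z hz => ?_
  · have h1 : ∏ i, ∏ a, reflSign (I ⟨i, a⟩) = ∏ x, reflSign (I x) :=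
      (Fintype.prod_sigma fun x => reflSign (I x)).symm
    have h2 : ∏ j, (reflSign (I (e (j, false))) * reflSign (I (e (j, true))))
        = ∏ x, reflSign (I x) := by
      rw [← e.prod_comp, Fintype.prod_prod_type]
      exact Finset.prod_congr rfl fun j _ => by rw [Fintype.prod_bool, mul_comm]
    rw [Finset.prod_mul_distrib, hsign, h1, h2, one_mul, ← Finset.prod_mul_distrib]
    exact Finset.prod_eq_one fun x _ => reflSign_mul_self _
  · unfold AH.fullContraction
    refine Finset.sum_congr rfl fun I _ => ?_
    have h1 : ∏ j : Fin r, (G z)⁻¹ (I (e (j, false))) (I (e (j, true)))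
        = z 0 ^ (2 * r) * ∏ j : Fin r, (H z)⁻¹ (I (e (j, false))) (I (e (j, true))) := by
      rw [Finset.prod_congr rfl fun j _ => h.inv z hz _ _, Finset.prod_mul_distrib]
      simp [pow_mul]
    unfold AH.frameNablaRm
    rw [h1, Finset.prod_mul_distrib, Finset.prod_pow_eq_pow_sum, hcard]
    ring

lemma IsConformalEven.scalarInvariants (hU : RelOpen U) (h : IsConformalEven U n G H)
    {P : E d → ℝ} (hP : P ∈ scalarInvariants G) : ParityBelow U n 1 P := by
  refine Submodule.span_induction ?_ ?_ ?_ ?_ hP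
  · rintro _ ⟨k, r, p, e, rfl⟩
    exact h.fullContraction hU p e
  · exact parityBelow_zero hU
  · exact fun _ _ _ _ h1 h2 => h1.add hU h2
  · exact fun c _ _ h1 => h1.const_mul hU c

/-- A metric `H` with even components, in coordinates in which `∂_x` is the gradient of `x`, and
a metric conformal to it. -/
lemma isConformalEven_of_even (hU : RelOpen U)
    (hGH : ∀ z ∈ interiorPart d U, ∀ s t, z 0 ^ 2 * G z s t = H z s t)
    (hH : ∀ s t, ParityBelow U n 1 (fun z => H z s t))
    (hsymm : ∀ z ∈ interiorPart d U, ∀ s t, H z s t = H z t s)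
    (hnormal : ∀ z ∈ interiorPart d U, ∀ s, H z 0 s = if s = 0 then 1 else 0)
    (hdet : ∀ z ∈ U, (H z).det ≠ 0)
    (hlim : ∀ z₀ ∈ U, z₀ 0 = 0 →
      ∀ s t, Tendsto (fun z => H z s t) (𝓝[interiorPart d U] z₀) (𝓝 (H z₀ s t))) :
    IsConformalEven U n G H := by
  -- Row 0 of H is the unit vector, so row 0 of H H⁻¹ = 1 reads off row 0 of H⁻¹.
  have hrow : ∀ z ∈ interiorPart d U, ∀ t, (H z)⁻¹ 0 t = if t = 0 then 1 else 0 := by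
    intro z hz t
    have h1 := congrFun (congrFun
      (Matrix.mul_nonsing_inv (H z) (isUnit_iff_ne_zero.2 (hdet z hz.1))) 0) t
    rw [Matrix.mul_apply] at h1
    simp only [hnormal z hz, ite_mul, one_mul, zero_mul, Finset.sum_ite_eq', Finset.mem_univ,
      if_true] at h1
    rw [h1, Matrix.one_apply]
    simp only [eq_comm]
  have hsymm' : ∀ z ∈ interiorPart d U, ∀ s t, (H z)⁻¹ s t = (H z)⁻¹ t s := by
    intro z hz s t
    have h1 : (H z).transpose = H z := Matrix.ext fun s t => hsymm z hz t s
    have h2 := Matrix.transpose_nonsing_inv (H z)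
    rw [h1] at h2
    exact congrFun (congrFun h2 t) s
  have hblock : ∀ A : MetricField d, (∀ z ∈ interiorPart d U, ∀ s t, A z s t = A z t s) →
      (∀ z ∈ interiorPart d U, ∀ t, A z 0 t = if t = 0 then 1 else 0) →
      ∀ z ∈ interiorPart d U, ∀ s t, (s = 0 ↔ ¬ t = 0) → A z s t = 0 := by
    intro A h1 h2 z hz s t hst
    by_cases hs : s = 0
    · subst hs
      rw [h2 z hz, if_neg (hst.1 rfl)]
    · have ht : t = 0 := by tauto
      rw [h1 z hz, ht, h2 z hz, if_neg hs]
  have hinv := ParityBelow.matrix_inv hU hH (fun z hz => hdet z hz.1) fun z₀ hz h0 =>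
    ⟨_, hdet z₀ hz, by
      have h1 : Tendsto H (𝓝[interiorPart d U] z₀) (𝓝 (H z₀)) :=
        tendsto_pi_nhds.2 fun s => tendsto_pi_nhds.2 fun t => hlim z₀ hz h0 s t
      exact ((Continuous.matrix_det continuous_id).tendsto (H z₀)).comp h1⟩
  refine ⟨hGH, fun z hz s t => ?_, parityBelow_of_block hU hH (hblock H hsymm hnormal),
    parityBelow_of_block hU hinv (hblock (fun z => (H z)⁻¹) hsymm' hrow)⟩
  have hz0 : z 0 ^ 2 ≠ 0 := pow_ne_zero _ hz.2.ne'
  have h1 : H z = z 0 ^ 2 • G z := Matrix.ext fun s t => (hGH z hz s t).symm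
  have h2 : G z * (z 0 ^ 2 • (H z)⁻¹) = 1 := by
    rw [Matrix.mul_smul, ← Matrix.smul_mul, ← h1]
    exact Matrix.mul_nonsing_inv _ (isUnit_iff_ne_zero.2 (hdet z hz.1))
  rw [Matrix.inv_eq_right_inv h2]
  rfl

end AH
end

/-! ### Passing from the manifold to coordinates. -/

noncomputable section

namespace AH

/-! ### Components of the metrics in an adapted chart -/

section Manifold

variable {d : ℕ} {M : Type*} [TopologicalSpace M]

lemma relOpen_chartImage (φ : OpenPartialHomeomorph M (EuclideanHalfSpace (d + 1))) :
    RelOpen (chartImage φ) := by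
  obtain ⟨O, hO, h⟩ := isOpen_induced_iff.1 φ.open_target
  refine ⟨O, hO, ?_⟩
  ext z
  simp only [chartImage, ← h, mem_image, mem_preimage, mem_inter_iff, mem_ofPred_eq]
  constructor
  · rintro ⟨w, hw, rfl⟩
    exact ⟨hw, w.2⟩
  · rintro ⟨h1, h2⟩
    exact ⟨⟨z, h2⟩, h1, rfl⟩

lemma symm_mem_target_of_mem_chartImage {φ : OpenPartialHomeomorph M (EuclideanHalfSpace (d + 1))}
    {z : E d} (hz : z ∈ chartImage φ) :
    (𝓡∂ (d + 1)).symm z ∈ φ.target ∧ (𝓡∂ (d + 1)) ((𝓡∂ (d + 1)).symm z) = z := by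
  obtain ⟨h, hh, rfl⟩ := hz
  rw [(𝓡∂ (d + 1)).left_inv]
  exact ⟨hh, rfl⟩

variable [ChartedSpace (EuclideanHalfSpace (d + 1)) M] [IsManifold (𝓡∂ (d + 1)) ∞ M]
  {φ : OpenPartialHomeomorph M (EuclideanHalfSpace (d + 1))}
  {g : BilinField d M} {x : M → ℝ}
  {gbar : Bundle.ContinuousRiemannianMetric (E d) (fun p : M => TangentSpace (𝓡∂ (d + 1)) p)}

lemma IsAdaptedChart.mdifferentiable {B : BilinField d M} (hφ : IsAdaptedChart x B φ) :
    φ.MDifferentiable (𝓡∂ (d + 1)) (𝓡∂ (d + 1)) :=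
  ⟨hφ.contMDiffOn.mdifferentiableOn one_ne_zero, hφ.contMDiffOn_symm.mdifferentiableOn one_ne_zero⟩

lemma sq_mul_components (hx : IsSpecialBdf g x gbar) (hφ : IsAdaptedChart x gbar.inner φ) {z : E d}
    (hz : z ∈ interiorPart d (chartImage φ)) (s t : Fin (d + 1)) :
    z 0 ^ 2 * components φ g z s t = components φ gbar.inner z s t := by
  obtain ⟨h1, h2⟩ := symm_mem_target_of_mem_chartImage hz.1
  have hxz : x (φ.symm ((𝓡∂ (d + 1)).symm z)) = z 0 := by
    rw [← hφ.normal_coord _ (φ.map_target h1), φ.right_inv h1]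
    exact congrArg (fun w : E d => w 0) h2
  -- x equals z 0 > 0 at this point, while x vanishes on the boundary.
  have hint : φ.symm ((𝓡∂ (d + 1)).symm z) ∈ (𝓡∂ (d + 1)).interior M := by
    rcases (𝓡∂ (d + 1)).isInteriorPoint_or_isBoundaryPoint
      (φ.symm ((𝓡∂ (d + 1)).symm z)) with h | h
    · exact h
    · have := hx.eq_zero _ h
      rw [hxz] at this
      exact absurd this hz.2.ne'
  unfold components
  rw [hx.conformal _ hint, hxz]
  rfl

/-- A kernel vector v of the Gram matrix gives w = ∑ v_s ∂_s with `gbar`(w, w) = 0. But w ≠ 0, as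
the differential of the inverse chart is injective, also at the boundary. -/
lemma det_components_ne_zero (hφ : IsAdaptedChart x gbar.inner φ) {z : E d}
    (hz : z ∈ chartImage φ) : (components φ gbar.inner z).det ≠ 0 := by
  obtain ⟨h1, -⟩ := symm_mem_target_of_mem_chartImage hz
  intro hdet
  obtain ⟨v, hv, hv0⟩ := Matrix.exists_mulVec_eq_zero_iff.2 hdet
  set h := (𝓡∂ (d + 1)).symm z
  set p := φ.symm h
  have hinj := hφ.mdifferentiable.symm.mfderiv_injective (x := h) h1
  set w : TangentSpace (𝓡∂ (d + 1)) p := ∑ s, v s • coordVec φ h s with hw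
  have hw0 : w ≠ 0 := by
    intro hw'
    have h2 : mfderiv (𝓡∂ (d + 1)) (𝓡∂ (d + 1)) φ.symm h (WithLp.toLp 2 v : E d) = w := by
      have h3 : (WithLp.toLp 2 v : E d) = ∑ s, v s • (EuclideanSpace.single s (1 : ℝ) : E d) := by
        ext i
        simp [Finset.sum_apply, Pi.single_apply]
      have h4 := map_sum (mfderiv (𝓡∂ (d + 1)) (𝓡∂ (d + 1)) φ.symm h)
        (fun s => v s • (EuclideanSpace.single s (1 : ℝ) : E d)) Finset.univ
      rw [h3]
      refine h4.trans (Finset.sum_congr rfl fun s _ => ?_)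
      exact map_smul (mfderiv (𝓡∂ (d + 1)) (𝓡∂ (d + 1)) φ.symm h) (v s) _
    have h3 : (WithLp.toLp 2 v : E d) = 0 := by
      refine hinj ?_
      rw [h2, hw']
      exact (map_zero (mfderiv (𝓡∂ (d + 1)) (𝓡∂ (d + 1)) φ.symm h)).symm
    exact hv (congrArg WithLp.ofLp h3)
  refine (gbar.pos p w hw0).ne' ?_
  have h2 : gbar.inner p w w = v ⬝ᵥ (components φ gbar.inner z).mulVec v := by
    rw [hw, map_sum]
    simp only [sum_apply, map_smul, smul_apply, map_sum, dotProduct,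
      Matrix.mulVec, smul_eq_mul]
    refine Finset.sum_congr rfl fun s _ => ?_
    congr 1
    exact Finset.sum_congr rfl fun t _ => by
      rw [gbar.symm]; exact mul_comm _ _
  rw [h2, hv0, dotProduct_zero]

/-- The coordinate field is the tangent map of the inverse chart along a constant section, so C¹ up
to the boundary suffices. -/
lemma continuousOn_coordVec {B : BilinField d M} (hφ : IsAdaptedChart x B φ) (s : Fin (d + 1)) :
    ContinuousOn (fun h => (⟨φ.symm h, coordVec φ h s⟩ : TangentBundle (𝓡∂ (d + 1)) M))
      φ.target := by
  have h1 := hφ.contMDiffOn_symm.continuousOn_tangentMapWithin le_rfl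
    φ.open_target.uniqueMDiffOn
  have h2 : Continuous (fun h : EuclideanHalfSpace (d + 1) =>
      (⟨h, (EuclideanSpace.single s (1 : ℝ) : E d)⟩ :
        TangentBundle (𝓡∂ (d + 1)) (EuclideanHalfSpace (d + 1)))) :=
    (tangentBundleModelSpaceHomeomorph (𝓡∂ (d + 1))).symm.continuous.comp
      (Continuous.prodMk continuous_id continuous_const)
  refine (h1.comp h2.continuousOn fun h hh => hh).congr fun h hh => ?_
  simp only [Function.comp, tangentMapWithin, coordVec]
  rw [mfderivWithin_of_isOpen φ.open_target hh]

open scoped Bundle in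
lemma continuousOn_components (hφ : IsAdaptedChart x gbar.inner φ) (s t : Fin (d + 1)) :
    ContinuousOn (fun h => gbar.inner (φ.symm h) (coordVec φ h s) (coordVec φ h t)) φ.target := by
  let _ : Bundle.RiemannianBundle (fun p : M => TangentSpace (𝓡∂ (d + 1)) p) :=
    ⟨gbar.toRiemannianMetric⟩
  exact ContinuousOn.inner_bundle (F := E d) (E := fun p : M => TangentSpace (𝓡∂ (d + 1)) p)
    (continuousOn_coordVec hφ s) (continuousOn_coordVec hφ t)

/-- The limit is over a full neighbourhood in ℝ^(d+1) because `components` factors through the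
inverse of the model embedding, which is continuous everywhere. -/
lemma tendsto_components (hφ : IsAdaptedChart x gbar.inner φ) {z₀ : E d}
    (hz : z₀ ∈ chartImage φ) (s t : Fin (d + 1)) :
    Tendsto (fun z => components φ gbar.inner z s t) (𝓝 z₀)
      (𝓝 (components φ gbar.inner z₀ s t)) :=
  ((continuousOn_components hφ s t).continuousAt (φ.open_target.mem_nhds
    (symm_mem_target_of_mem_chartImage hz).1)).tendsto.comp
      ((𝓡∂ (d + 1)).continuous_symm.tendsto z₀)

lemma isConformalEven_components (hx : IsSpecialBdf g x gbar) (hφ : IsAdaptedChart x gbar.inner φ)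
    {n : ℕ} (heven : ∀ s t : Fin (d + 1),
      ParityBelow (chartImage φ) n 1 (fun z => components φ gbar.inner z s t)) :
    IsConformalEven (chartImage φ) n (components φ g) (components φ gbar.inner) :=
  isConformalEven_of_even (relOpen_chartImage φ) (fun _ hz => sq_mul_components hx hφ hz) heven
    (fun _ _ _ _ => gbar.symm _ _ _) (fun z hz => hφ.orthogonal z hz.1)
    (fun _ hz => det_components_ne_zero hφ hz)
    (fun _ hz _ s t => (tendsto_components hφ hz s t).mono_left nhdsWithin_le_nhds)

end Manifold

end AH

end

theorem mainTheorem8 {d : ℕ} {M : Type*} [TopologicalSpace M]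
    [ChartedSpace (EuclideanHalfSpace (d + 1)) M] [IsManifold (𝓡∂ (d + 1)) ∞ M]
    (g : AH.BilinField d M) (x : M → ℝ)
    (gbar : Bundle.ContinuousRiemannianMetric (AH.E d)
      (fun p : M => TangentSpace (𝓡∂ (d + 1)) p))
    (hx : AH.IsSpecialBdf g x gbar)
    (φ : OpenPartialHomeomorph M (EuclideanHalfSpace (d + 1)))
    (hφ : AH.IsAdaptedChart x gbar.inner φ)
    (n : ℕ)
    (heven : ∀ s t : Fin (d + 1),
      AH.ParityBelow (AH.chartImage φ) n 1 (fun z => AH.components φ gbar.inner z s t)) :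
    (∀ (p : ℕ) (J : Fin (4 + p) → Fin (d + 1)),
      AH.ParityBelow (AH.chartImage φ) n ((-1) ^ (p + AH.numNormal J))
        (AH.frameNablaRm (AH.components φ g) p J)) ∧
    (∀ P ∈ AH.scalarInvariants (AH.components φ g),
      AH.ParityBelow (AH.chartImage φ) n 1 P) := by
  have hU := AH.relOpen_chartImage φ
  have h := AH.isConformalEven_components hx hφ heven
  refine ⟨fun p J => ?_, fun P hP => h.scalarInvariants hU hP⟩
  rw [pow_add, ← AH.prod_reflSign]
  exact h.frameNablaRm hU p J
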